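/- **Setting.** Let $(V,E,(\nu_e)_{e\in E},(\tau_e)_{e\in E})$ be a network with capacities $\nu_e>0$ and transit times $\tau_e>0$, and let $J$ be a finite set of commodities. Each $j\in J$ has a fixed simple path $P_j$ (with at least one arc) from $o_j$ to $d_j$ and an integrable, bounded supply rate $u_j\colon[0,\infty)\to[0,\infty)$ with bounded support; put $m_j=\int_0^\infty u_j$ and $\delta=\min_{e}\tau_e/2$. *Flow over time.* Let $f=(f^+_{j,e},f^-_{j,e})$ be a feasible flow over time in which commodity $j$ uses only $P_j$: the rates are nonnegative, bounded, locally integrable, and $0$ before time $0$; with $F_e^\pm(\theta)=\sum_j\int_0^\theta f^\pm_{j,e}$, $z_e(\theta)=F_e^+(\theta-\tau_e)-F_e^-(\theta)$ and $T_e(\theta)=\theta+\tau_e+z_e(\theta+\tau_e)/\nu_e$, for almost every $\theta\ge0$: (i) for every $j$ and $v$ the difference $\sum_{e\in\delta_v^+}f^+_{j,e}(\theta)-\sum_{e\in\delta_v^-}f^-_{j,e}(\theta)$ is $0$ for $v\ne o_j,d_j$, equals $u_j(\theta)$ for $v=o_j$, and is $\le0$ for $v=d_j$; (ii) $f_e^-(\theta)=\nu_e$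 if $z_e(\theta)>0$ and $f_e^-(\theta)=\min\{f_e^+(\theta-\tau_e),\nu_e\}$ if $z_e(\theta)=0$, these two cases being exhaustive; (iii) with $\vartheta=\min\{\xi\le\theta: T_e(\xi)=\theta\}$, $f^-_{j,e}(\theta)=f^-_e(\theta)f^+_{j,e}(\vartheta)/f^+_e(\vartheta)$ if $f_e^+(\vartheta)>0$, and $0$ otherwise. The arrival times of a particle $\phi\in[0,m_j]$ are $\ell_{j,o_j}(\phi)=\min\{\theta\ge0:\int_0^\theta u_j=\phi\}$ and $\ell_{j,v}(\phi)=T_e(\ell_{j,u}(\phi))$ for each arc $e=uv$ of $P_j$. Let $H=\max_j\ell_{j,d_j}(m_j)$ be the time when the last particle leaves the network. *Packet routing.* Let $\alpha,\beta>0$. Commodity $j$ has packets $i=1,\dots,\lfloor m_j/\beta\rfloor$ with path $P_j$; packet $i$ is released at $o_j$ in time step $\min\{t\in\mathbb N_0:\int_0^{\alpha t}u_j\ge i\beta\}$. Put $\hat\tau_e=\lceil\tau_e/\alpha\rceil$ and $\hat\nu_e=\nu_e\alpha/\beta$. Every arc is a first-in-first-out queue, initially empty, with current capacity $\hat\nu_e(0)=\hat\nu_e$.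 In step $t=0,1,2,\dots$ the buffer $B_e(t)$ consists of the packets on $e$ that entered $e$ in a step $\le t-\hat\tau_e$; the first $\lfloor\hat\nu_e(t)\rfloor$ of them (or all, if there are fewer) leave $e$. Then $\hat\nu_e(t+1)=\hat\nu_e$ if $|B_e(t)|\le\hat\nu_e(t)$, and $\hat\nu_e(t+1)=\hat\nu_e+\hat\nu_e(t)-\lfloor\hat\nu_e(t)\rfloor$ otherwise. Each leaving packet moves to the next arc of its path (or leaves the network at its destination), and released packets enter their first arc. The packets entering an arc $e=vw$ in step $t$ are appended to its queue in the following order. For every arc $e'$ into $v$, and for the packets released at $v$ (ordered by index), let $y$ be the number of packets from this source that want to enter $e$; if $y\ge1$ the source gets a counter with initial value $1/y$. Repeatedly a source with smallest counter among those with packets remaining sends its next packet, and its counter grows by $1/y$. Ties are broken by an arbitrary deterministic rule, and the indexing of all packets is arbitrary except that it is increasing in $i$ within each commodity. Let $g^{\pm}_{j,e}(\theta)$ be $\beta/\alpha$ times the number of packets of $j$ that enter (respectively leave) $e$ in step $\lceil\theta/\alpha\rceil$, and $G^\pm_{j,e}(\theta)=\int_0^\theta g^\pm_{j,e}$. The refined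 arrival time is $\ell^D_{j,v}(i)=\min\{\theta\ge0: G(\theta)\ge i\beta\}$, where $G=G^-_{j,uv}$ for the arc $uv\in P_j$ ending in $v$, and, if $v=o_j$, $G=G^+_{j,e}$ for the first arc $e$ of $P_j$. **Theorem.** There is a constant $C>1$ that depends only on the network and on the paths and supply rates of the commodities such that the following holds for every $f$ as above. Let $\alpha,\beta>0$ be so small that $$\sqrt\alpha<\delta\, C^{-H/\delta},\qquad \frac\beta\alpha<1,\qquad \frac{\nu_e\alpha}{\beta}\ge2\ \text{ for all } e\in E .$$ Then, for every tie-breaking rule and indexing of the packets, every commodity $j$, every node $v$ of $P_j$ and every packet $i$ of $j$ with corresponding particle $\phi=i\beta$, the minima defining $\ell_{j,o_j}(\phi)$ and $\ell^D_{j,v}(i)$ exist, and $$\bigl|\ell_{j,v}(\phi)-\ell^D_{j,v}(i)\bigr|\le\sqrt\alpha\cdot C^{K}$$ for every $K\in\mathbb N$ with $\ell_{j,v}(\phi)<K\delta$ or $\ell^D_{j,v}(i)<K\delta$. -/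

import Mathlib

open MeasureTheory

noncomputable section

/-- A network: a directed graph (arcs `e` with tail `src e` and head `tgt e`) whose arcs carry
positive transit times `τ` and positive capacities `ν`. -/
structure Network (V E : Type*) where
  src : E → V
  tgt : E → V
  τ : E → ℝ
  ν : E → ℝ
  τ_pos : ∀ e, 0 < τ e
  ν_pos : ∀ e, 0 < ν e

namespace Network

variable {V E : Type*} (G : Network V E)

/-- The nodes visited by a sequence of arcs, in order. -/
def nodes : List E → List V
  | [] => []
  | e :: es => G.src e :: (e :: es).map G.tgt

/-- A simple path with at least one arc, given by its sequence of arcs. -/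
def IsSimplePath (p : List E) : Prop :=
  p ≠ [] ∧ p.IsChain (fun e e' => G.tgt e = G.src e') ∧ (G.nodes p).Nodup

/-- Half of the smallest transit time. -/
def halfMinTransit : ℝ := ⨅ e, G.τ e / 2

end Network

/-- A network with commodities, each with a fixed simple path and an integrable bounded supply rate
`u j : [0, ∞) → [0, ∞)` of bounded support (values of `u j` at negative times are irrelevant). -/
structure LoadingInstance (V E J : Type*) extends Network V E where
  path : J → List E
  path_simple : ∀ j, toNetwork.IsSimplePath (path j)
  u : J → ℝ → ℝ
  u_nonneg : ∀ j θ, 0 ≤ θ → 0 ≤ u j θ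
  u_integrable : ∀ j, IntegrableOn (u j) (Set.Ici 0)
  u_bounded : ∀ j, ∃ B : ℝ, ∀ θ, 0 ≤ θ → u j θ ≤ B
  u_support : ∀ j, ∃ B : ℝ, ∀ θ, B < θ → u j θ = 0

namespace LoadingInstance

variable {V E J : Type*} (I : LoadingInstance V E J)

/-- The origin of commodity `j`. -/
def origin (j : J) : V := I.src ((I.path j).head (I.path_simple j).1)

/-- The destination of commodity `j`. -/
def dest (j : J) : V := I.tgt ((I.path j).getLast (I.path_simple j).1)

/-- The volume supplied by commodity `j` up to time `θ`. -/
def cumSupply (j : J) (θ : ℝ) : ℝ := ∫ ξ in (0 : ℝ)..θ, I.u j ξ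

/-- The total volume `m j` of commodity `j`. -/
def mass (j : J) : ℝ := ∫ ξ in Set.Ici (0 : ℝ), I.u j ξ

end LoadingInstance

/-! ### Flows over time -/

/-- In- and outflow rates of every commodity on every arc. -/
structure FlowRates (E J : Type*) where
  inflow : J → E → ℝ → ℝ
  outflow : J → E → ℝ → ℝ

namespace FlowRates

variable {V E J : Type*} [Fintype J] (f : FlowRates E J) (G : Network V E)

/-- Total inflow rate into `e`. -/
def totIn (e : E) (θ : ℝ) : ℝ := ∑ j, f.inflow j e θ

/-- Total outflow rate of `e`. -/
def totOut (e : E) (θ : ℝ) : ℝ := ∑ j, f.outflow j e θ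

/-- Total cumulative inflow into `e`. -/
def cumIn (e : E) (θ : ℝ) : ℝ := ∑ j, ∫ ξ in (0 : ℝ)..θ, f.inflow j e ξ

/-- Total cumulative outflow of `e`. -/
def cumOut (e : E) (θ : ℝ) : ℝ := ∑ j, ∫ ξ in (0 : ℝ)..θ, f.outflow j e ξ

/-- Queue volume on `e` at time `θ`. -/
def queue (e : E) (θ : ℝ) : ℝ := f.cumIn e (θ - G.τ e) - f.cumOut e θ

/-- Waiting time of particles entering `e` at time `θ`. -/
def waiting (e : E) (θ : ℝ) : ℝ := f.queue G e (θ + G.τ e) / G.ν e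

/-- Exit time of particles entering `e` at time `θ`. -/
def exitTime (e : E) (θ : ℝ) : ℝ := θ + G.τ e + f.waiting G e θ

/-- Feasible flows over time for the supply rates of `I` in which commodity `j` uses only the
arcs of its path. -/
structure IsFeasible [DecidableEq V] [Fintype E] (I : LoadingInstance V E J) : Prop where
  in_bounded : ∀ j e, ∃ B : ℝ, ∀ θ, |f.inflow j e θ| ≤ B
  out_bounded : ∀ j e, ∃ B : ℝ, ∀ θ, |f.outflow j e θ| ≤ B
  in_integrable : ∀ j e, LocallyIntegrable (f.inflow j e)
  out_integrable : ∀ j e, LocallyIntegrable (f.outflow j e)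
  in_nonneg : ∀ j e, ∀ᵐ θ, 0 ≤ f.inflow j e θ
  out_nonneg : ∀ j e, ∀ᵐ θ, 0 ≤ f.outflow j e θ
  in_neg_time : ∀ j e θ, θ < 0 → f.inflow j e θ = 0
  out_neg_time : ∀ j e θ, θ < 0 → f.outflow j e θ = 0
  /-- commodity `j` uses only its path -/
  in_off_path : ∀ j e, e ∉ I.path j → ∀ᵐ θ, f.inflow j e θ = 0
  out_off_path : ∀ j e, e ∉ I.path j → ∀ᵐ θ, f.outflow j e θ = 0
  /-- flow conservation -/
  conservation : ∀ j v, ∀ᵐ θ, 0 ≤ θ →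
    let net := (∑ e with I.src e = v, f.inflow j e θ) - ∑ e with I.tgt e = v, f.outflow j e θ
    (v ≠ I.origin j → v ≠ I.dest j → net = 0) ∧
      (v = I.origin j → net = I.u j θ) ∧ (v = I.dest j → net ≤ 0)
  /-- queues operate at capacity rate -/
  capacity : ∀ e, ∀ᵐ θ, 0 ≤ θ →
    (0 < f.queue I.toNetwork e θ ∧ f.totOut e θ = I.ν e) ∨
      (f.queue I.toNetwork e θ = 0 ∧ f.totOut e θ = min (f.totIn e (θ - I.τ e)) (I.ν e))
  /-- first in first out: proportions of the commodities are preserved -/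
  fifo : ∀ j e, ∀ᵐ θ, 0 ≤ θ →
    ∃ ϑ, IsLeast {ξ | ξ ≤ θ ∧ f.exitTime I.toNetwork e ξ = θ} ϑ ∧
      f.outflow j e θ =
        if 0 < f.totIn e ϑ then f.totOut e θ * (f.inflow j e ϑ / f.totIn e ϑ) else 0

end FlowRates

namespace LoadingInstance

variable {V E J : Type*} (I : LoadingInstance V E J)

/-- The times `θ ≥ 0` at which exactly the volume `φ` of commodity `j` has been supplied; the
particle `φ` enters the network at the least of them. -/
def entrySet (j : J) (φ : ℝ) : Set ℝ := {θ | 0 ≤ θ ∧ I.cumSupply j θ = φ}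

/-- Time at which a particle reaches `v` when it is at the tail of the first arc of the given path
at the given time and traverses each arc `e` according to the exit time function `T e`. -/
def arrivalAlong [DecidableEq V] (T : E → ℝ → ℝ) (v : V) : List E → ℝ → ℝ
  | [], θ => θ
  | e :: es, θ => if I.src e = v then θ else arrivalAlong T v es (T e θ)

/-- Arrival time of particle `φ` of commodity `j` at the node `v` of its path. -/
def arrival [Fintype J] [DecidableEq V] (f : FlowRates E J) (j : J) (v : V) (φ : ℝ) : ℝ :=
  I.arrivalAlong (f.exitTime I.toNetwork) v (I.path j) (sInf (I.entrySet j φ))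

/-- The time when the last particle leaves the network. -/
def horizon [Fintype J] [DecidableEq V] (f : FlowRates E J) : ℝ :=
  ⨆ j, I.arrival f j (I.dest j) (I.mass j)

end LoadingInstance

/-! ### The packet routing model -/

/-- A rule that breaks ties in the merging procedure. At time step `t`, when the packets in `Y`
still have to enter arc `e` and the nonempty set `S` consists of the sources of highest priority,
the rule selects an element of `S`. The source `some e'` is the arc `e'`, the source `none`
stands for the packets released at the tail of `e`. -/
structure TieRule (E P : Type*) where
  pick : ℕ → E → (Option E → List P) → Finset (Option E) → Option E
  pick_mem : ∀ t e Y S, S.Nonempty → pick t e Y S ∈ S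

/-- A discretized network together with packets: `packets` lists all packets in the order of their
index. -/
structure PacketRouting (E P : Type*) where
  tauHat : E → ℕ
  nuHat : E → ℝ
  packets : List P
  path : P → List E
  release : P → ℕ
  tie : TieRule E P

/-- The state of the network at the beginning of a time step: the packets on each arc (first in
line first), labelled with the time step at which they entered it, and the current capacities. -/
structure LoadState (E P : Type*) where
  queue : E → List (P × ℕ)
  cap : E → ℝ

namespace PacketRouting

variable {E P : Type*} [Fintype E] [DecidableEq E] (R : PacketRouting E P)

/-- The loop of the merging procedure for arc `e` in step `t`: `y` are the initial numbers of packets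
of the sources, `Y` the remaining packets and `a` the priority counters. The first argument bounds
the number of iterations. -/
def mergeLoop (t : ℕ) (e : E) (y : Option E → ℕ) :
    ℕ → (Option E → List P) → (Option E → ℚ) → List P
  | 0, _, _ => []
  | n + 1, Y, a =>
    let A : Finset (Option E) := {s | (Y s).length ≠ 0}
    let S : Finset (Option E) := {s ∈ A | ∀ s' ∈ A, a s ≤ a s'}
    let s := R.tie.pick t e Y S
    match Y s with
    | [] => []
    | p :: ps =>
      p :: mergeLoop t e y n (Function.update Y s ps) (Function.update a s (a s + 1 / (y s : ℚ)))

/-- Merging of the packets in `Y` that want to enter arc `e` in step `t`. -/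
def merge (t : ℕ) (e : E) (Y : Option E → List P) : List P :=
  R.mergeLoop t e (fun s => (Y s).length) (∑ s, (Y s).length) Y
    (fun s => 1 / ((Y s).length : ℚ))

/-- The packets that have spent enough time on `e` to leave it in step `t`. -/
def buffer (s : LoadState E P) (t : ℕ) (e : E) : List (P × ℕ) :=
  (s.queue e).takeWhile (fun x => x.2 + R.tauHat e ≤ t)

/-- The packets leaving `e` in step `t`. -/
def leavingOf (s : LoadState E P) (t : ℕ) (e : E) : List P :=
  ((R.buffer s t e).take ⌊s.cap e⌋₊).map Prod.fst

/-- For every source, the packets that want to enter `e` from it in step `t`. -/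
def wanting (s : LoadState E P) (t : ℕ) (e : E) : Option E → List P
  | none => R.packets.filter (fun p => R.release p = t ∧ (R.path p).head? = some e)
  | some e' => (R.leavingOf s t e').filter (fun p => [e', e] <:+: R.path p)

/-- The packets entering `e` in step `t`. -/
def enteringOf (s : LoadState E P) (t : ℕ) (e : E) : List P :=
  R.merge t e (R.wanting s t e)

/-- One time step of the network loading. -/
def step (s : LoadState E P) (t : ℕ) : LoadState E P where
  queue e := (s.queue e).drop (R.leavingOf s t e).length ++ (R.enteringOf s t e).map (fun p => (p, t))
  cap e :=
    if ((R.buffer s t e).length : ℝ) ≤ s.cap e then R.nuHat e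
    else R.nuHat e + s.cap e - ⌊s.cap e⌋₊

/-- The network loading. -/
def state : ℕ → LoadState E P
  | 0 => ⟨fun _ => [], R.nuHat⟩
  | t + 1 => R.step (state t) t

/-- The packets leaving `e` in time step `t`. -/
def leaving (t : ℕ) (e : E) : List P := R.leavingOf (R.state t) t e

/-- The packets entering `e` in time step `t`. -/
def entering (t : ℕ) (e : E) : List P := R.enteringOf (R.state t) t e

end PacketRouting

/-! ### The packet routing induced by a flow over time instance -/

namespace LoadingInstance

variable {V E J : Type*} (I : LoadingInstance V E J)

/-- `L` lists all packets of all commodities for packet size `β`: the packet `(j, i)` is the `i`-th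
packet of commodity `j`. Packets of the same commodity are listed by increasing number. -/
def IsPacketList (β : ℝ) (L : List (J × ℕ)) : Prop :=
  L.Pairwise (fun p q => p.1 = q.1 → p.2 < q.2) ∧
    ∀ j i, (j, i) ∈ L ↔ 1 ≤ i ∧ i ≤ ⌊I.mass j / β⌋₊

/-- The packet routing induced by the discretization parameters `α` and `β`. -/
def induced (α β : ℝ) (L : List (J × ℕ)) (tie : TieRule E (J × ℕ)) :
    PacketRouting E (J × ℕ) where
  tauHat e := ⌈I.τ e / α⌉₊
  nuHat e := I.ν e * α / β
  packets := L
  path p := I.path p.1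
  release p := sInf {t : ℕ | p.2 * β ≤ I.cumSupply p.1 (t * α)}
  tie := tie

end LoadingInstance

namespace PacketRouting

variable {E J : Type*} [Fintype E] [DecidableEq E] [DecidableEq J] (R : PacketRouting E (J × ℕ))

/-- Inflow rate of commodity `j` into `e`, constant during each time step. -/
def inRate (α β : ℝ) (j : J) (e : E) (θ : ℝ) : ℝ :=
  β / α * (R.entering ⌈θ / α⌉₊ e).countP (fun p => p.1 = j)

/-- Outflow rate of commodity `j` out of `e`, constant during each time step. -/
def outRate (α β : ℝ) (j : J) (e : E) (θ : ℝ) : ℝ :=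
  β / α * (R.leaving ⌈θ / α⌉₊ e).countP (fun p => p.1 = j)

/-- Cumulative inflow of commodity `j` into `e`. -/
def cumIn (α β : ℝ) (j : J) (e : E) (θ : ℝ) : ℝ := ∫ ξ in (0 : ℝ)..θ, R.inRate α β j e ξ

/-- Cumulative outflow of commodity `j` out of `e`. -/
def cumOut (α β : ℝ) (j : J) (e : E) (θ : ℝ) : ℝ := ∫ ξ in (0 : ℝ)..θ, R.outRate α β j e ξ

end PacketRouting

namespace LoadingInstance

variable {V E J : Type*} [DecidableEq V] [Fintype E] [DecidableEq E] [DecidableEq J]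
  (I : LoadingInstance V E J)

/-- The cumulative packet volume of commodity `j` that has reached the node `v` of its path: the
cumulative outflow of the arc of the path that ends in `v` or, if `v` is the origin, the cumulative
inflow into the first arc. -/
def cumAt (R : PacketRouting E (J × ℕ)) (α β : ℝ) (j : J) (v : V) : ℝ → ℝ :=
  match (I.path j).find? (fun e => I.tgt e = v) with
  | some e => R.cumOut α β j e
  | none => R.cumIn α β j ((I.path j).head (I.path_simple j).1)

/-- The times at which at least the volume `i * β` of commodity `j` has reached `v`. -/
def refinedSet (R : PacketRouting E (J × ℕ)) (α β : ℝ) (j : J) (v : V) (i : ℕ) : Set ℝ :=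
  {θ | 0 ≤ θ ∧ i * β ≤ I.cumAt R α β j v θ}

/-- The refined arrival time of packet `i` of commodity `j` at the node `v` of its path. -/
def refinedArrival (R : PacketRouting E (J × ℕ)) (α β : ℝ) (j : J) (v : V) (i : ℕ) : ℝ :=
  sInf (I.refinedSet R α β j v i)

end LoadingInstance

end

/-! ### Flows over time on a single arc -/

/-! In both models the exit time of whatever enters an arc is determined, up to rounding, by the
cumulative inflow curve of that arc. For the flow, `exists_exitTime_eq` together with
`div_le_exitTime_sub` and `add_le_exitTime` gives T(θ) = τ + max over 0 ≤ s ≤ θ of s + (F(θ) -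
F(s))/ν for θ ≥ 0, the maximum being attained at the last s whose particle finds an empty queue. For
packets, `exists_exit_le` and `le_exit` give the same formula up to one packet, because the capacity
carried over between steps stays below one packet. Hence close inflow curves yield close exit times
(`abs_exitTime_sub_le`).

Conversely, close arrival times at the tail of an arc yield close inflow curves, since inflow rates
are bounded independently of the flow (`exists_inflow_bound`, `ArrivalsClose.abs_inVol_sub_le`).
FIFO transfers statements about total volumes to single commodities: for the flow this is
`outVol_exitTime`, for packets `leftCount_eq`. The order produced by merging never matters, because
only the number of packets of each commodity entering in each step is used (`countP_merge`); this is
why tie-breaking and indexing are arbitrary.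

Let δ be half the smallest transit time. Whatever reaches the head of an arc before Θ + δ was at its
tail before Θ, with a further δ to spare for the error. So closeness ε before Θ implies closeness Cε
before Θ + δ (`ArrivalsClose.add_halfMinTransit`), and induction on K gives the bound
(`arrivalsClose_mul_halfMinTransit`). The smallness of α keeps the error below δ as long as Kδ ≤ H;
beyond H every particle has arrived and nothing is left to propagate. -/

lemma intervalIntegrable_of_locallyIntegrable {g : ℝ → ℝ} (hg : LocallyIntegrable g) (a b : ℝ) :
    IntervalIntegrable g volume a b :=
  (hg.integrableOn_isCompact isCompact_uIcc).intervalIntegrable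

lemma integral_eq_zero_of_neg_time {g : ℝ → ℝ} (hg : ∀ θ, θ < 0 → g θ = 0) {θ : ℝ} (h : θ ≤ 0) :
    ∫ ξ in (0 : ℝ)..θ, g ξ = 0 := by
  refine intervalIntegral.integral_zero_ae ?_
  filter_upwards [Measure.ae_ne volume (0 : ℝ)] with x hx hmem
  rw [Set.uIoc_of_ge h] at hmem
  exact hg x (lt_of_le_of_ne hmem.2 hx)

/-- Expresses cumulative volumes as measures of half-lines, the form in which `outVol_exitTime`
compares inflow and outflow measures. -/
lemma setLIntegral_Iic_ofReal {g : ℝ → ℝ} (hg : LocallyIntegrable g) (h0 : ∀ᵐ θ, 0 ≤ g θ)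
    (hneg : ∀ θ, θ < 0 → g θ = 0) (b : ℝ) :
    ∫⁻ ξ in Set.Iic b, ENNReal.ofReal (g ξ) = ENNReal.ofReal (∫ ξ in (0 : ℝ)..b, g ξ) := by
  have h1 : ∫⁻ ξ in Set.Iic b, ENNReal.ofReal (g ξ) =
      ∫⁻ ξ in Set.Ioc 0 b, ENNReal.ofReal (g ξ) := by
    rw [← lintegral_indicator measurableSet_Iic, ← lintegral_indicator measurableSet_Ioc]
    refine lintegral_congr_ae ?_
    filter_upwards [Measure.ae_ne volume (0 : ℝ)] with x hx
    rcases lt_or_gt_of_ne hx with hx | hx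
    · simp [Set.indicator, hneg x hx]
    · simp [Set.indicator, hx]
  rw [h1]
  rcases le_total 0 b with hb | hb
  · rw [intervalIntegral.integral_of_le hb, ofReal_integral_eq_lintegral_ofReal]
    · exact ((intervalIntegrable_of_locallyIntegrable hg 0 b).1)
    · exact ae_restrict_of_ae h0
  · rw [Set.Ioc_eq_empty (by simpa using hb), integral_eq_zero_of_neg_time hneg hb]
    simp

namespace FlowRates

/-- Cumulative inflow of commodity `j` into `e`. -/
noncomputable def inVol {E J : Type*} (f : FlowRates E J) (j : J) (e : E) (θ : ℝ) : ℝ :=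
  ∫ ξ in (0 : ℝ)..θ, f.inflow j e ξ

/-- Cumulative outflow of commodity `j` out of `e`. -/
noncomputable def outVol {E J : Type*} (f : FlowRates E J) (j : J) (e : E) (θ : ℝ) : ℝ :=
  ∫ ξ in (0 : ℝ)..θ, f.outflow j e ξ

/-- The first summand is the time needed to process the inflow of [a, b], the second the capacity
left idle during [a + τ, b + τ]. For a ≤ b both are nonnegative in a feasible flow. -/
lemma exitTime_sub {V E J : Type*} [Fintype J] (f : FlowRates E J) (I : LoadingInstance V E J)
    (e : E) (a b : ℝ) :
    f.exitTime I.toNetwork e b - f.exitTime I.toNetwork e a =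
      (f.cumIn e b - f.cumIn e a) / I.ν e +
      (I.ν e * (b - a) - (f.cumOut e (b + I.τ e) - f.cumOut e (a + I.τ e))) / I.ν e := by
  have := (I.ν_pos e).ne'
  unfold exitTime waiting queue
  rw [add_sub_cancel_right, add_sub_cancel_right]
  field_simp
  ring

namespace IsFeasible

variable {V E J : Type*} [Fintype J] [DecidableEq V] [Fintype E] {I : LoadingInstance V E J}
  {f : FlowRates E J}

lemma inflow_intervalIntegrable (hf : f.IsFeasible I) (j : J) (e : E) (a b : ℝ) :
    IntervalIntegrable (f.inflow j e) volume a b :=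
  intervalIntegrable_of_locallyIntegrable (hf.in_integrable j e) a b

lemma outflow_intervalIntegrable (hf : f.IsFeasible I) (j : J) (e : E) (a b : ℝ) :
    IntervalIntegrable (f.outflow j e) volume a b :=
  intervalIntegrable_of_locallyIntegrable (hf.out_integrable j e) a b

lemma totIn_locallyIntegrable (hf : f.IsFeasible I) (e : E) : LocallyIntegrable (f.totIn e) :=
  locallyIntegrable_finsetSum _ fun j _ => hf.in_integrable j e

lemma totOut_locallyIntegrable (hf : f.IsFeasible I) (e : E) : LocallyIntegrable (f.totOut e) :=
  locallyIntegrable_finsetSum _ fun j _ => hf.out_integrable j e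

lemma totIn_intervalIntegrable (hf : f.IsFeasible I) (e : E) (a b : ℝ) :
    IntervalIntegrable (f.totIn e) volume a b :=
  intervalIntegrable_of_locallyIntegrable (hf.totIn_locallyIntegrable e) a b

lemma totOut_intervalIntegrable (hf : f.IsFeasible I) (e : E) (a b : ℝ) :
    IntervalIntegrable (f.totOut e) volume a b :=
  intervalIntegrable_of_locallyIntegrable (hf.totOut_locallyIntegrable e) a b

lemma cumIn_eq (hf : f.IsFeasible I) (e : E) (θ : ℝ) :
    f.cumIn e θ = ∫ ξ in (0 : ℝ)..θ, f.totIn e ξ := by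
  unfold cumIn totIn
  rw [intervalIntegral.integral_finsetSum]
  exact fun j _ => hf.inflow_intervalIntegrable j e 0 θ

lemma cumOut_eq (hf : f.IsFeasible I) (e : E) (θ : ℝ) :
    f.cumOut e θ = ∫ ξ in (0 : ℝ)..θ, f.totOut e ξ := by
  unfold cumOut totOut
  rw [intervalIntegral.integral_finsetSum]
  exact fun j _ => hf.outflow_intervalIntegrable j e 0 θ

lemma cumIn_sub (hf : f.IsFeasible I) (e : E) (a b : ℝ) :
    f.cumIn e b - f.cumIn e a = ∫ ξ in a..b, f.totIn e ξ := by
  rw [hf.cumIn_eq, hf.cumIn_eq]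
  exact intervalIntegral.integral_interval_sub_left (hf.totIn_intervalIntegrable e _ _)
    (hf.totIn_intervalIntegrable e _ _)

lemma cumOut_sub (hf : f.IsFeasible I) (e : E) (a b : ℝ) :
    f.cumOut e b - f.cumOut e a = ∫ ξ in a..b, f.totOut e ξ := by
  rw [hf.cumOut_eq, hf.cumOut_eq]
  exact intervalIntegral.integral_interval_sub_left (hf.totOut_intervalIntegrable e _ _)
    (hf.totOut_intervalIntegrable e _ _)

lemma inVol_sub (hf : f.IsFeasible I) (j : J) (e : E) (a b : ℝ) :
    f.inVol j e b - f.inVol j e a = ∫ ξ in a..b, f.inflow j e ξ :=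
  intervalIntegral.integral_interval_sub_left (hf.inflow_intervalIntegrable j e _ _)
    (hf.inflow_intervalIntegrable j e _ _)

lemma totIn_nonneg (hf : f.IsFeasible I) (e : E) : ∀ᵐ θ, 0 ≤ f.totIn e θ := by
  have h : ∀ᵐ θ, ∀ j, 0 ≤ f.inflow j e θ := ae_all_iff.2 fun j => hf.in_nonneg j e
  filter_upwards [h] with θ h using Finset.sum_nonneg fun j _ => h j

lemma totOut_nonneg (hf : f.IsFeasible I) (e : E) : ∀ᵐ θ, 0 ≤ f.totOut e θ := by
  have h : ∀ᵐ θ, ∀ j, 0 ≤ f.outflow j e θ := ae_all_iff.2 fun j => hf.out_nonneg j e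
  filter_upwards [h] with θ h using Finset.sum_nonneg fun j _ => h j

lemma totIn_neg_time (hf : f.IsFeasible I) (e : E) {θ : ℝ} (h : θ < 0) : f.totIn e θ = 0 :=
  Finset.sum_eq_zero fun j _ => hf.in_neg_time j e θ h

lemma totOut_neg_time (hf : f.IsFeasible I) (e : E) {θ : ℝ} (h : θ < 0) : f.totOut e θ = 0 :=
  Finset.sum_eq_zero fun j _ => hf.out_neg_time j e θ h

lemma totOut_le (hf : f.IsFeasible I) (e : E) : ∀ᵐ θ, f.totOut e θ ≤ I.ν e := by
  filter_upwards [hf.capacity e] with θ h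
  rcases lt_or_ge θ 0 with h0 | h0
  · rw [hf.totOut_neg_time e h0]
    exact (I.ν_pos e).le
  · rcases h h0 with h | h
    · exact h.2.le
    · exact h.2.le.trans (min_le_right _ _)

lemma outflow_le (hf : f.IsFeasible I) (j : J) (e : E) : ∀ᵐ θ, f.outflow j e θ ≤ I.ν e := by
  have h : ∀ᵐ θ, ∀ j, 0 ≤ f.outflow j e θ := ae_all_iff.2 fun j => hf.out_nonneg j e
  filter_upwards [h, hf.totOut_le e] with θ h h'
  exact (Finset.single_le_sum (f := fun j => f.outflow j e θ) (fun j _ => h j)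
    (Finset.mem_univ j)).trans h'

lemma cumIn_mono (hf : f.IsFeasible I) (e : E) : Monotone (f.cumIn e) := by
  intro a b hab
  rw [← sub_nonneg, hf.cumIn_sub]
  exact intervalIntegral.integral_nonneg_of_ae hab (hf.totIn_nonneg e)

lemma cumOut_mono (hf : f.IsFeasible I) (e : E) : Monotone (f.cumOut e) := by
  intro a b hab
  rw [← sub_nonneg, hf.cumOut_sub]
  exact intervalIntegral.integral_nonneg_of_ae hab (hf.totOut_nonneg e)

lemma inVol_mono (hf : f.IsFeasible I) (j : J) (e : E) : Monotone (f.inVol j e) := by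
  intro a b hab
  rw [← sub_nonneg, hf.inVol_sub]
  exact intervalIntegral.integral_nonneg_of_ae hab (hf.in_nonneg j e)

lemma cumOut_sub_le (hf : f.IsFeasible I) (e : E) {a b : ℝ} (hab : a ≤ b) :
    f.cumOut e b - f.cumOut e a ≤ I.ν e * (b - a) := by
  rw [hf.cumOut_sub]
  refine (intervalIntegral.integral_mono_ae hab (hf.totOut_intervalIntegrable e _ _)
    (intervalIntegrable_const (c := I.ν e)) (hf.totOut_le e)).trans ?_
  simp [mul_comm]

lemma continuous_cumIn (hf : f.IsFeasible I) (e : E) : Continuous (f.cumIn e) := by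
  have : f.cumIn e = fun θ => ∫ ξ in (0 : ℝ)..θ, f.totIn e ξ := funext (hf.cumIn_eq e)
  rw [this]
  exact intervalIntegral.continuous_primitive (hf.totIn_intervalIntegrable e) 0

lemma continuous_cumOut (hf : f.IsFeasible I) (e : E) : Continuous (f.cumOut e) := by
  have : f.cumOut e = fun θ => ∫ ξ in (0 : ℝ)..θ, f.totOut e ξ := funext (hf.cumOut_eq e)
  rw [this]
  exact intervalIntegral.continuous_primitive (hf.totOut_intervalIntegrable e) 0

lemma continuous_queue (hf : f.IsFeasible I) (e : E) :
    Continuous (f.queue I.toNetwork e) :=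
  ((hf.continuous_cumIn e).comp (continuous_id.sub continuous_const)).sub (hf.continuous_cumOut e)

lemma cumIn_of_nonpos (hf : f.IsFeasible I) (e : E) {θ : ℝ} (h : θ ≤ 0) : f.cumIn e θ = 0 := by
  rw [hf.cumIn_eq]
  exact integral_eq_zero_of_neg_time (fun _ h => hf.totIn_neg_time e h) h

lemma cumOut_of_nonpos (hf : f.IsFeasible I) (e : E) {θ : ℝ} (h : θ ≤ 0) : f.cumOut e θ = 0 := by
  rw [hf.cumOut_eq]
  exact integral_eq_zero_of_neg_time (fun _ h => hf.totOut_neg_time e h) h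

/-- The two cases of the capacity condition exclude negative queues at almost every time. By
continuity a negative value would persist on an interval of positive measure. -/
lemma queue_nonneg (hf : f.IsFeasible I) (e : E) (θ : ℝ) : 0 ≤ f.queue I.toNetwork e θ := by
  rcases lt_or_ge θ 0 with h | h
  · unfold queue
    rw [hf.cumOut_of_nonpos e h.le, sub_zero,
      hf.cumIn_of_nonpos e (by linarith [I.τ_pos e])]
  · by_contra! hlt
    have hopen : IsOpen {x | f.queue I.toNetwork e x < 0} :=
      isOpen_lt (hf.continuous_queue e) continuous_const
    obtain ⟨ε, hε, hball⟩ := Metric.isOpen_iff.1 hopen θ hlt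
    have hsub : Set.Ioo θ (θ + ε) ⊆ {x | ¬ (0 ≤ x →
        (0 < f.queue I.toNetwork e x ∧ f.totOut e x = I.ν e) ∨
        (f.queue I.toNetwork e x = 0 ∧
          f.totOut e x = min (f.totIn e (x - I.τ e)) (I.ν e)))} := by
      intro x hx hcon
      have hx' : f.queue I.toNetwork e x < 0 := hball (by
        rw [Metric.mem_ball, Real.dist_eq, abs_lt]
        constructor <;> linarith [hx.1, hx.2])
      rcases hcon (h.trans hx.1.le) with h | h <;> linarith [h.1]
    have h0 := measure_mono_null hsub (hf.capacity e)
    rw [Real.volume_Ioo] at h0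
    simp only [add_sub_cancel_left, ENNReal.ofReal_eq_zero] at h0
    linarith

lemma totOut_eq_of_queue_pos (hf : f.IsFeasible I) (e : E) :
    ∀ᵐ θ, 0 < f.queue I.toNetwork e θ → f.totOut e θ = I.ν e := by
  filter_upwards [hf.capacity e] with θ h hpos
  rcases lt_or_ge θ 0 with hθ | hθ
  · unfold queue at hpos
    rw [hf.cumOut_of_nonpos e hθ.le, sub_zero,
      hf.cumIn_of_nonpos e (by linarith [I.τ_pos e])] at hpos
    exact absurd hpos (lt_irrefl _)
  · rcases h hθ with h | h
    · exact h.2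
    · linarith [h.1]

lemma cumOut_sub_of_queue_pos (hf : f.IsFeasible I) (e : E) {a b : ℝ} (hab : a ≤ b)
    (hpos : ∀ x, a < x → x < b → 0 < f.queue I.toNetwork e x) :
    f.cumOut e b - f.cumOut e a = I.ν e * (b - a) := by
  rw [hf.cumOut_sub]
  have : ∫ ξ in a..b, f.totOut e ξ = ∫ ξ in a..b, I.ν e := by
    refine intervalIntegral.integral_congr_ae ?_
    filter_upwards [hf.totOut_eq_of_queue_pos e, Measure.ae_ne volume b] with x hx hxb hmem
    rw [Set.uIoc_of_le hab] at hmem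
    exact hx (hpos x hmem.1 (lt_of_le_of_ne hmem.2 hxb))
  rw [this]
  simp [mul_comm]

/-- The lower half of the maximum formula for the exit time: everything that enters between a and b
has to be served before a particle entering at b, at rate at most ν. -/
lemma div_le_exitTime_sub (hf : f.IsFeasible I) (e : E) {a b : ℝ} (hab : a ≤ b) :
    (f.cumIn e b - f.cumIn e a) / I.ν e ≤
      f.exitTime I.toNetwork e b - f.exitTime I.toNetwork e a := by
  rw [exitTime_sub f I e a b]
  have h := hf.cumOut_sub_le e (a := a + I.τ e) (b := b + I.τ e) (by linarith)
  have : 0 ≤ (I.ν e * (b - a) - (f.cumOut e (b + I.τ e) - f.cumOut e (a + I.τ e))) / I.ν e :=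
    div_nonneg (by linarith) (I.ν_pos e).le
  linarith

lemma exitTime_mono (hf : f.IsFeasible I) (e : E) : Monotone (f.exitTime I.toNetwork e) := by
  intro a b hab
  have h1 := hf.div_le_exitTime_sub e hab
  have h2 := div_nonneg (sub_nonneg.2 (hf.cumIn_mono e hab)) (I.ν_pos e).le
  linarith

lemma add_le_exitTime (hf : f.IsFeasible I) (e : E) (θ : ℝ) :
    θ + I.τ e ≤ f.exitTime I.toNetwork e θ := by
  unfold exitTime waiting
  have := div_nonneg (hf.queue_nonneg e (θ + I.τ e)) (I.ν_pos e).le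
  linarith

lemma queue_add_transit_of_nonpos (hf : f.IsFeasible I) (e : E) {θ : ℝ} (h : θ ≤ 0) :
    f.queue I.toNetwork e (θ + I.τ e) = 0 := by
  refine le_antisymm ?_ (hf.queue_nonneg e _)
  unfold queue
  rw [add_sub_cancel_right, hf.cumIn_of_nonpos e h]
  rcases le_total (θ + I.τ e) 0 with h3 | h3
  · rw [hf.cumOut_of_nonpos e h3]; simp
  · have := hf.cumOut_mono e h3
    rw [hf.cumOut_of_nonpos e le_rfl] at this
    linarith

lemma exitTime_of_nonpos (hf : f.IsFeasible I) (e : E) {θ : ℝ} (h : θ ≤ 0) :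
    f.exitTime I.toNetwork e θ = θ + I.τ e := by
  unfold exitTime waiting
  rw [hf.queue_add_transit_of_nonpos e h]
  simp

lemma continuous_exitTime (hf : f.IsFeasible I) (e : E) :
    Continuous (f.exitTime I.toNetwork e) := by
  unfold exitTime waiting
  have := (hf.continuous_queue e).comp (continuous_id.add (continuous_const (y := I.τ e)))
  exact (continuous_id.add continuous_const).add (this.div_const _)

/-- The waiting time is the queue length divided by ν, and the queue cannot empty earlier since
outflow is at most ν. So the arc works at full rate until the exit time and serves exactly the queue
found on arrival. -/
lemma cumOut_exitTime (hf : f.IsFeasible I) (e : E) (θ : ℝ) :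
    f.cumOut e (f.exitTime I.toNetwork e θ) = f.cumIn e θ := by
  have hν := I.ν_pos e
  have hle := hf.add_le_exitTime e θ
  have hT : I.ν e * (f.exitTime I.toNetwork e θ - (θ + I.τ e)) =
      f.cumIn e θ - f.cumOut e (θ + I.τ e) := by
    unfold exitTime waiting queue
    rw [add_sub_cancel_right]
    field_simp
    ring
  have h := hf.cumOut_sub_of_queue_pos e hle (fun x h1 h2 => ?_)
  · linarith
  · have h3 := hf.cumOut_sub_le e h1.le
    have h4 := hf.cumIn_mono e (show θ ≤ x - I.τ e by linarith)
    have h5 : I.ν e * (x - (θ + I.τ e)) <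
        I.ν e * (f.exitTime I.toNetwork e θ - (θ + I.τ e)) :=
      mul_lt_mul_of_pos_left (by linarith) hν
    unfold queue
    linarith

/-- A particle entering at time `θ` waits behind everything that entered since the queue was last
empty. -/
lemma exists_exitTime_eq (hf : f.IsFeasible I) (e : E) {θ : ℝ} (hθ : 0 ≤ θ) :
    ∃ s, 0 ≤ s ∧ s ≤ θ ∧
      f.exitTime I.toNetwork e θ = s + I.τ e + (f.cumIn e θ - f.cumIn e s) / I.ν e := by
  -- The largest s at which an entering particle meets an empty queue. After s + τ the queue stays
  -- positive, so no capacity is idle and the second term of `exitTime_sub` vanishes.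
  let S : Set ℝ := Set.Icc 0 θ ∩ {s | f.queue I.toNetwork e (s + I.τ e) = 0}
  have hS : IsCompact S := isCompact_Icc.inter_right
    (isClosed_eq ((hf.continuous_queue e).comp (continuous_id.add continuous_const))
      continuous_const)
  obtain ⟨s, ⟨hs, hs0⟩, hmax⟩ := hS.exists_isGreatest
    ⟨0, ⟨le_rfl, hθ⟩, hf.queue_add_transit_of_nonpos e le_rfl⟩
  refine ⟨s, hs.1, hs.2, ?_⟩
  have hTs : f.exitTime I.toNetwork e s = s + I.τ e := by
    unfold exitTime waiting
    rw [Set.mem_ofPred_eq] at hs0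
    rw [hs0]; simp
  have h := hf.cumOut_sub_of_queue_pos e (a := s + I.τ e) (b := θ + I.τ e) (by linarith [hs.2])
    (fun x h1 h2 => ?_)
  · have := exitTime_sub f I e s θ
    rw [h, hTs] at this
    have h0 : I.ν e * (θ - s) - I.ν e * (θ + I.τ e - (s + I.τ e)) = 0 := by ring
    rw [h0, zero_div] at this
    linarith
  · refine lt_of_le_of_ne (hf.queue_nonneg e x) (fun h0 => ?_)
    have : x - I.τ e ≤ s := hmax ⟨⟨by linarith [hs.1], by linarith⟩, by
      simp only [Set.mem_ofPred_eq, sub_add_cancel]; exact h0.symm⟩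
    linarith

/-- A generalized inverse of the exit time: the lower adjoint, given by the infimum of all ξ with η
≤ T(ξ). These sets are bounded below because T is a translation at nonpositive times, and continuity
of T makes it an exact right inverse. -/
lemma exists_entryTime (hf : f.IsFeasible I) (e : E) :
    ∃ ϑ : ℝ → ℝ, (∀ η a, ϑ η ≤ a ↔ η ≤ f.exitTime I.toNetwork e a) ∧
      ∀ η, f.exitTime I.toNetwork e (ϑ η) = η := by
  set T := f.exitTime I.toNetwork e with hTdef
  have hτ := I.τ_pos e
  have hne : ∀ η, {ξ | η ≤ T ξ}.Nonempty := fun η =>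
    ⟨η, by have := hf.add_le_exitTime e η; simp only [Set.mem_ofPred_eq]; linarith⟩
  have hbdd : ∀ η, BddBelow {ξ | η ≤ T ξ} := fun η => by
    refine ⟨min 0 (η - I.τ e), fun ξ hξ => ?_⟩
    by_contra! hlt
    have h1 := hf.exitTime_of_nonpos e (hlt.le.trans (min_le_left _ _))
    have h2 := hlt.trans_le (min_le_right _ _)
    simp only [Set.mem_ofPred_eq] at hξ
    linarith
  have hclosed : ∀ η, IsClosed {ξ | η ≤ T ξ} := fun η =>
    isClosed_le continuous_const (hf.continuous_exitTime e)
  have hmem : ∀ η, η ≤ T (sInf {ξ | η ≤ T ξ}) := fun η =>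
    (hclosed η).csInf_mem (hne η) (hbdd η)
  refine ⟨fun η => sInf {ξ | η ≤ T ξ}, fun η a => ⟨fun h => ?_, fun h => csInf_le (hbdd η) h⟩,
    fun η => le_antisymm ?_ (hmem η)⟩
  · exact (hmem η).trans (hf.exitTime_mono e h)
  · refine le_of_tendsto ((hf.continuous_exitTime e).continuousWithinAt
      (s := Set.Iio (sInf {ξ | η ≤ T ξ}))) ?_
    filter_upwards [self_mem_nhdsWithin] with x hx
    by_contra! hlt
    exact absurd (csInf_le (hbdd η) hlt.le) (not_le.2 hx)

/-- The flow of every commodity that has entered `e` by time `θ` has left it by the exit time. -/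
lemma outVol_exitTime (hf : f.IsFeasible I) (j : J) (e : E) (a : ℝ) :
    f.outVol j e (f.exitTime I.toNetwork e a) = f.inVol j e a := by
  obtain ⟨ϑ, hgal, hT⟩ := hf.exists_entryTime e
  set T := f.exitTime I.toNetwork e with hTdef
  have hϑmono : Monotone ϑ := fun x y hxy => (hgal x (ϑ y)).2 (by rw [hT]; exact hxy)
  have hϑmeas : Measurable ϑ := hϑmono.measurable
  set μo : Measure ℝ := (volume.restrict (Set.Iic (T a))).withDensity
    (fun η => ENNReal.ofReal (f.totOut e η)) with hμo
  set μi : Measure ℝ := (volume.restrict (Set.Iic a)).withDensity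
    (fun ξ => ENNReal.ofReal (f.totIn e ξ)) with hμi
  have hout : ∀ b, ∫⁻ η in Set.Iic b, ENNReal.ofReal (f.totOut e η) =
      ENNReal.ofReal (f.cumOut e b) := fun b => by
    rw [hf.cumOut_eq]
    exact setLIntegral_Iic_ofReal (hf.totOut_locallyIntegrable e) (hf.totOut_nonneg e)
      (fun _ => hf.totOut_neg_time e) b
  have hin : ∀ b, ∫⁻ η in Set.Iic b, ENNReal.ofReal (f.totIn e η) =
      ENNReal.ofReal (f.cumIn e b) := fun b => by
    rw [hf.cumIn_eq]
    exact setLIntegral_Iic_ofReal (hf.totIn_locallyIntegrable e) (hf.totIn_nonneg e)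
      (fun _ => hf.totIn_neg_time e) b
  -- Pulling leaving particles back to their entry times turns the total outflow measure into the
  -- total inflow measure. On half-lines this is `cumOut_exitTime`, and finite measures on the line
  -- are determined by half-lines.
  have hmap : μo.map ϑ = μi := by
    have hfin : IsFiniteMeasure (μo.map ϑ) := by
      have : IsFiniteMeasure μo := ⟨by
        rw [hμo, withDensity_apply _ MeasurableSet.univ, Measure.restrict_univ, hout]
        exact ENNReal.ofReal_lt_top⟩
      infer_instance
    refine Measure.ext_of_Iic _ _ fun b => ?_
    rw [Measure.map_apply hϑmeas measurableSet_Iic, hμo, hμi,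
      withDensity_apply _ (hϑmeas measurableSet_Iic), withDensity_apply _ measurableSet_Iic,
      Measure.restrict_restrict (hϑmeas measurableSet_Iic),
      Measure.restrict_restrict measurableSet_Iic]
    have : ϑ ⁻¹' Set.Iic b ∩ Set.Iic (T a) = Set.Iic (T (min b a)) := by
      ext η
      simp only [Set.mem_inter_iff, Set.mem_preimage, Set.mem_Iic]
      rw [← hgal, ← hgal, le_min_iff]
    rw [this, hout, Set.Iic_inter_Iic, hin, hf.cumOut_exitTime]
  have hinm : AEMeasurable (f.inflow j e) := (hf.in_integrable j e).aestronglyMeasurable.aemeasurable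
  have htim : AEMeasurable (f.totIn e) := (hf.totIn_locallyIntegrable e).aestronglyMeasurable.aemeasurable
  have htom : AEMeasurable (f.totOut e) :=
    (hf.totOut_locallyIntegrable e).aestronglyMeasurable.aemeasurable
  -- The share of commodity `j` in the inflow. The truncation at 0 makes the quotient 0 by division
  -- by zero where the total inflow is not positive, matching the second case of the FIFO condition.
  set r : ℝ → ENNReal := fun ξ => ENNReal.ofReal (f.inflow j e ξ / max (f.totIn e ξ) 0) with hr
  have hrm : AEMeasurable r := (hinm.div (htim.max aemeasurable_const)).ennreal_ofReal
  have hac : μi ≪ volume :=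
    (withDensity_absolutelyContinuous _ _).trans Measure.absolutelyContinuous_restrict
  have hrmi : AEMeasurable r μi := hrm.mono_ac hac
  have key : ∫⁻ η, (r ∘ ϑ) η ∂μo = ∫⁻ ξ, r ξ ∂μi := by
    rw [← hmap, lintegral_map' (hmap ▸ hrmi) hϑmeas.aemeasurable]
    rfl
  have hro : AEMeasurable (r ∘ ϑ) μo :=
    AEMeasurable.comp_aemeasurable (hmap ▸ hrmi) hϑmeas.aemeasurable
  rw [hμo, hμi, lintegral_withDensity_eq_lintegral_mul₀' htom.ennreal_ofReal.restrict hro,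
    lintegral_withDensity_eq_lintegral_mul₀' htim.ennreal_ofReal.restrict hrmi] at key
  have hL : ∫⁻ η in Set.Iic (T a), ((fun η => ENNReal.ofReal (f.totOut e η)) * (r ∘ ϑ)) η =
      ∫⁻ η in Set.Iic (T a), ENNReal.ofReal (f.outflow j e η) := by
    refine lintegral_congr_ae (ae_restrict_of_ae ?_)
    filter_upwards [hf.fifo j e, hf.totOut_nonneg e] with η hη h0
    simp only [Pi.mul_apply, Function.comp_apply, hr]
    rcases lt_or_ge η 0 with hneg | hpos
    · rw [hf.totOut_neg_time e hneg, hf.out_neg_time j e η hneg]; simp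
    · obtain ⟨x, hx, heq⟩ := hη hpos
      -- The entry time in the FIFO condition is the least preimage of η under the exit time, which
      -- is the value of the lower adjoint.
      have hxϑ : x = ϑ η := by
        refine le_antisymm (hx.2 ⟨?_, hT η⟩) ((hgal _ _).2 hx.1.2.ge)
        have := hf.add_le_exitTime e (ϑ η)
        rw [← hTdef, hT] at this
        linarith [I.τ_pos e]
      rw [heq, hxϑ, ← ENNReal.ofReal_mul h0]
      split_ifs with hti
      · rw [max_eq_left hti.le]
      · rw [max_eq_right (not_lt.1 hti)]; simp
  have hR : ∫⁻ ξ in Set.Iic a, ((fun ξ => ENNReal.ofReal (f.totIn e ξ)) * r) ξ =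
      ∫⁻ ξ in Set.Iic a, ENNReal.ofReal (f.inflow j e ξ) := by
    refine lintegral_congr_ae (ae_restrict_of_ae ?_)
    have hall : ∀ᵐ θ, ∀ j, 0 ≤ f.inflow j e θ := ae_all_iff.2 fun j => hf.in_nonneg j e
    filter_upwards [hall, hf.totIn_nonneg e] with ξ h0 h1
    simp only [Pi.mul_apply, hr]
    rw [← ENNReal.ofReal_mul h1, max_eq_left h1]
    rcases h1.eq_or_lt with h2 | h2
    · have : f.inflow j e ξ ≤ f.totIn e ξ :=
        Finset.single_le_sum (f := fun j => f.inflow j e ξ) (fun j _ => h0 j) (Finset.mem_univ j)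
      rw [← h2] at this ⊢
      rw [le_antisymm this (h0 j)]; simp
    · rw [mul_div_cancel₀ _ h2.ne']
  rw [hL, hR, setLIntegral_Iic_ofReal (hf.out_integrable j e) (hf.out_nonneg j e)
    (hf.out_neg_time j e), setLIntegral_Iic_ofReal (hf.in_integrable j e) (hf.in_nonneg j e)
    (hf.in_neg_time j e)] at key
  have h0i : 0 ≤ f.inVol j e a := by
    rcases le_total 0 a with h | h
    · exact intervalIntegral.integral_nonneg_of_ae h (hf.in_nonneg j e)
    · exact (integral_eq_zero_of_neg_time (hf.in_neg_time j e) h).ge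
  have h0o : 0 ≤ f.outVol j e (T a) := by
    rcases le_total 0 (T a) with h | h
    · exact intervalIntegral.integral_nonneg_of_ae h (hf.out_nonneg j e)
    · exact (integral_eq_zero_of_neg_time (hf.out_neg_time j e) h).ge
  exact (ENNReal.ofReal_eq_ofReal_iff h0o h0i).1 key

end IsFeasible
end FlowRates

/-! ### Simple paths -/

namespace Network

variable {V E : Type*} (G : Network V E)

lemma length_nodes {p : List E} (hp : p ≠ []) : (G.nodes p).length = p.length + 1 := by
  cases p with
  | nil => exact absurd rfl hp
  | cons e es => simp [nodes]

lemma nodes_getElem_succ {p : List E} {k : ℕ} (hk : k < p.length)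
    (h : k + 1 < (G.nodes p).length) : (G.nodes p)[k + 1] = G.tgt p[k] := by
  cases p with
  | nil => simp at hk
  | cons e es => exact List.getElem_map G.tgt (l := e :: es) (h := by simpa using hk)

lemma nodes_getElem {p : List E} (hc : p.IsChain (fun e e' => G.tgt e = G.src e')) {k : ℕ}
    (hk : k < p.length) (h : k < (G.nodes p).length) : (G.nodes p)[k] = G.src p[k] := by
  cases k with
  | zero =>
    cases p with
    | nil => simp at hk
    | cons e es => simp [nodes]
  | succ k =>
    rw [G.nodes_getElem_succ (by omega) h]
    exact List.isChain_iff_getElem.1 hc k hk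

end Network

namespace LoadingInstance

variable {V E J : Type*} (I : LoadingInstance V E J)

lemma length_path_pos (j : J) : 0 < (I.path j).length :=
  List.length_pos_iff.2 (I.path_simple j).1

/-- The `k`-th node of the path of commodity `j`. -/
noncomputable def nodeAt (j : J) (k : ℕ) : V :=
  (I.nodes (I.path j)).getD k (I.origin j)

variable {I}

lemma nodeAt_eq_src {j : J} {k : ℕ} (hk : k < (I.path j).length) :
    I.nodeAt j k = I.src (I.path j)[k] := by
  have h : k < (I.nodes (I.path j)).length := by
    rw [I.length_nodes (I.path_simple j).1]; omega
  unfold nodeAt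
  rw [List.getD_eq_getElem _ _ h, I.nodes_getElem (I.path_simple j).2.1 hk h]

lemma nodeAt_succ {j : J} {k : ℕ} (hk : k < (I.path j).length) :
    I.nodeAt j (k + 1) = I.tgt (I.path j)[k] := by
  have h : k + 1 < (I.nodes (I.path j)).length := by
    rw [I.length_nodes (I.path_simple j).1]; omega
  unfold nodeAt
  rw [List.getD_eq_getElem _ _ h, I.nodes_getElem_succ hk h]

lemma nodeAt_inj {j : J} {k l : ℕ} (hk : k ≤ (I.path j).length) (hl : l ≤ (I.path j).length)
    (h : I.nodeAt j k = I.nodeAt j l) : k = l := by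
  have hlen := I.length_nodes (I.path_simple j).1
  unfold nodeAt at h
  rw [List.getD_eq_getElem _ _ (by omega), List.getD_eq_getElem _ _ (by omega)] at h
  exact ((I.path_simple j).2.2.getElem_inj_iff).1 h

lemma exists_nodeAt_eq {j : J} {v : V} (hv : v ∈ I.nodes (I.path j)) :
    ∃ k ≤ (I.path j).length, v = I.nodeAt j k := by
  have hlen := I.length_nodes (I.path_simple j).1
  obtain ⟨k, hk, rfl⟩ := List.getElem_of_mem hv
  exact ⟨k, by omega, by unfold nodeAt; rw [List.getD_eq_getElem _ _ hk]⟩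

lemma origin_eq (j : J) : I.origin j = I.nodeAt j 0 := by
  rw [nodeAt_eq_src (I.length_path_pos j)]
  unfold origin
  rw [List.head_eq_getElem]

lemma dest_eq (j : J) : I.dest j = I.nodeAt j (I.path j).length := by
  have h := I.length_path_pos j
  obtain ⟨n, hn⟩ : ∃ n, (I.path j).length = n + 1 := ⟨_, (Nat.succ_pred_eq_of_pos h).symm⟩
  rw [hn, nodeAt_succ (by omega)]
  unfold dest
  rw [List.getLast_eq_getElem]
  simp [hn]

lemma path_getElem_inj {j : J} {k l : ℕ} (hk : k < (I.path j).length) (hl : l < (I.path j).length)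
    (h : (I.path j)[k] = (I.path j)[l]) : k = l :=
  nodeAt_inj hk.le hl.le (by rw [nodeAt_eq_src hk, nodeAt_eq_src hl, h])

/-- The recursion stops at the first arc with tail `v`. The second hypothesis is vacuous when `k` is
the length of the path: no arc starts at the destination and the recursion runs to the end. -/
lemma arrivalAlong_eq [DecidableEq V] (T : E → ℝ → ℝ) (v : V) (p : List E) (k : ℕ) (θ : ℝ)
    (h1 : ∀ l (hl : l < p.length), l < k → I.src p[l] ≠ v)
    (h2 : ∀ h : k < p.length, I.src p[k] = v) :
    I.arrivalAlong T v p θ = (p.take k).foldl (fun θ e => T e θ) θ := by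
  induction p generalizing k θ with
  | nil => simp [arrivalAlong]
  | cons e es ih =>
    cases k with
    | zero =>
      have := h2 (by simp)
      simp only [List.getElem_cons_zero] at this
      simp [arrivalAlong, this]
    | succ k =>
      have := h1 0 (by simp) (by omega)
      simp only [List.getElem_cons_zero] at this
      simp only [arrivalAlong, this, if_false, List.take_succ_cons, List.foldl_cons]
      refine ih k _ (fun l hl hlk => ?_) (fun h => ?_)
      · exact h1 (l + 1) (by simpa using hl) (by omega)
      · exact h2 (by simpa using h)

lemma find?_nodeAt_zero [DecidableEq V] (j : J) :
    (I.path j).find? (fun e => I.tgt e = I.nodeAt j 0) = none := by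
  rw [List.find?_eq_none]
  intro e he
  obtain ⟨k, hk, rfl⟩ := List.getElem_of_mem he
  rw [← nodeAt_succ hk, decide_eq_true_iff]
  intro h
  exact absurd (nodeAt_inj (by omega) (by omega) h) (by omega)

lemma find?_nodeAt_succ [DecidableEq V] {j : J} {k : ℕ} (hk : k < (I.path j).length) :
    (I.path j).find? (fun e => I.tgt e = I.nodeAt j (k + 1)) = some (I.path j)[k] := by
  rw [List.find?_eq_some_iff_getElem]
  refine ⟨by simp [nodeAt_succ hk], k, hk, rfl, fun l hl => ?_⟩
  have hl' : l < (I.path j).length := by omega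
  simp only [Bool.not_eq_eq_eq_not, Bool.not_true, decide_eq_false_iff_not]
  rw [← nodeAt_succ hl']
  intro h
  exact absurd (nodeAt_inj (by omega) (by omega) h) (by omega)

/-! ### Supply -/

lemma mass_eq (j : J) : I.mass j = ∫ ξ in Set.Ioi (0 : ℝ), I.u j ξ := integral_Ici_eq_integral_Ioi

lemma cumSupply_eq {j : J} {θ : ℝ} (h : 0 ≤ θ) :
    I.cumSupply j θ = ∫ ξ in Set.Ioc (0 : ℝ) θ, I.u j ξ := intervalIntegral.integral_of_le h

lemma u_integrableOn (j : J) : IntegrableOn (I.u j) (Set.Ioi 0) :=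
  (I.u_integrable j).mono_set Set.Ioi_subset_Ici_self

lemma cumSupply_mono {j : J} {a b : ℝ} (ha : 0 ≤ a) (hab : a ≤ b) :
    I.cumSupply j a ≤ I.cumSupply j b := by
  rw [cumSupply_eq ha, cumSupply_eq (ha.trans hab)]
  refine setIntegral_mono_set ((I.u_integrableOn j).mono_set Set.Ioc_subset_Ioi_self) ?_
    (Set.Ioc_subset_Ioc_right hab).eventuallyLE
  filter_upwards [ae_restrict_mem measurableSet_Ioc] with x hx using I.u_nonneg j x hx.1.le

lemma cumSupply_zero (j : J) : I.cumSupply j 0 = 0 := by simp [cumSupply]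

lemma cumSupply_le_mass {j : J} {a : ℝ} (ha : 0 ≤ a) : I.cumSupply j a ≤ I.mass j := by
  rw [cumSupply_eq ha, mass_eq]
  refine setIntegral_mono_set (I.u_integrableOn j) ?_ Set.Ioc_subset_Ioi_self.eventuallyLE
  filter_upwards [ae_restrict_mem measurableSet_Ioi] with x hx using I.u_nonneg j x (le_of_lt hx)

lemma exists_cumSupply_eq_mass (j : J) : ∃ b, 0 ≤ b ∧ ∀ θ, b ≤ θ → I.cumSupply j θ = I.mass j := by
  obtain ⟨B, hB⟩ := I.u_support j
  refine ⟨max B 0, le_max_right _ _, fun θ hθ => ?_⟩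
  rw [cumSupply_eq ((le_max_right _ _).trans hθ), mass_eq]
  symm
  refine setIntegral_eq_of_subset_of_forall_sdiff_eq_zero measurableSet_Ioi
    Set.Ioc_subset_Ioi_self fun x hx => hB x ?_
  have : θ < x := by
    by_contra! h
    exact hx.2 ⟨hx.1, h⟩
  exact ((le_max_left _ _).trans hθ).trans_lt this

/-! ### Arrival times -/

/-- Arrival time of particle `φ` of commodity `j` at the `k`-th node of its path. -/
noncomputable def arrivalAt [Fintype J] (I : LoadingInstance V E J) (f : FlowRates E J) (j : J)
    (φ : ℝ) (k : ℕ) : ℝ :=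
  ((I.path j).take k).foldl (fun θ e => f.exitTime I.toNetwork e θ) (sInf (I.entrySet j φ))

lemma arrivalAt_zero [Fintype J] (f : FlowRates E J) (j : J) (φ : ℝ) :
    I.arrivalAt f j φ 0 = sInf (I.entrySet j φ) := by simp [arrivalAt]

lemma arrivalAt_succ [Fintype J] (f : FlowRates E J) {j : J} (φ : ℝ) {k : ℕ}
    (hk : k < (I.path j).length) :
    I.arrivalAt f j φ (k + 1) = f.exitTime I.toNetwork (I.path j)[k] (I.arrivalAt f j φ k) := by
  unfold arrivalAt
  rw [List.take_succ_eq_append_getElem hk, List.foldl_append]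
  rfl

lemma arrival_nodeAt [Fintype J] [DecidableEq V] (f : FlowRates E J) {j : J} (φ : ℝ) {k : ℕ}
    (hk : k ≤ (I.path j).length) : I.arrival f j (I.nodeAt j k) φ = I.arrivalAt f j φ k := by
  unfold arrival arrivalAt
  refine arrivalAlong_eq _ _ _ _ _ (fun l hl hlk => ?_) (fun h => (nodeAt_eq_src h).symm)
  rw [← nodeAt_eq_src hl]
  intro h
  exact absurd (nodeAt_inj hl.le hk h) (by omega)

lemma halfMinTransit_le [Fintype E] (e : E) : 2 * I.halfMinTransit ≤ I.τ e := by
  have : I.halfMinTransit ≤ I.τ e / 2 := ciInf_le (Set.finite_range _).bddBelow e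
  linarith

lemma halfMinTransit_pos [Fintype E] [Nonempty E] : 0 < I.halfMinTransit := by
  obtain ⟨e, he⟩ := exists_eq_ciInf_of_finite (f := fun e => I.τ e / 2)
  have : I.halfMinTransit = I.τ e / 2 := he.symm
  rw [this]
  exact half_pos (I.τ_pos e)

end LoadingInstance

/-! ### Flow along a path -/

namespace FlowRates.IsFeasible

open LoadingInstance

variable {V E J : Type*} [Fintype J] [DecidableEq V] [Fintype E] {I : LoadingInstance V E J}
  {f : FlowRates E J}

/-- On a simple path the first arc is the only one leaving the origin and none enters it, so flow
conservation reduces to a single term. -/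
lemma inflow_first (hf : f.IsFeasible I) (j : J) :
    ∀ᵐ θ, 0 ≤ θ → f.inflow j ((I.path j)[0]'(I.length_path_pos j)) θ = I.u j θ := by
  have hin : ∀ᵐ θ, ∀ e, e ∉ I.path j → f.inflow j e θ = 0 :=
    ae_all_iff.2 fun e => by
      by_cases h : e ∈ I.path j
      · simp [h]
      · filter_upwards [hf.in_off_path j e h] with θ hθ _ using hθ
  have hout : ∀ᵐ θ, ∀ e, e ∉ I.path j → f.outflow j e θ = 0 :=
    ae_all_iff.2 fun e => by
      by_cases h : e ∈ I.path j
      · simp [h]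
      · filter_upwards [hf.out_off_path j e h] with θ hθ _ using hθ
  filter_upwards [hf.conservation j (I.origin j), hin, hout] with θ hc hi ho h0
  have h := (hc h0).2.1 rfl
  have hpos := I.length_path_pos j
  rw [Finset.sum_eq_single ((I.path j)[0]'hpos), Finset.sum_eq_zero, sub_zero] at h
  · exact h
  · intro e he
    refine ho e fun hmem => ?_
    obtain ⟨l, hl, rfl⟩ := List.getElem_of_mem hmem
    rw [Finset.mem_filter, ← nodeAt_succ hl, origin_eq] at he
    exact absurd (nodeAt_inj hl (Nat.zero_le _) he.2) (by omega)
  · intro e he hne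
    refine hi e fun hmem => ?_
    obtain ⟨l, hl, rfl⟩ := List.getElem_of_mem hmem
    rw [Finset.mem_filter, ← nodeAt_eq_src hl, origin_eq] at he
    have := nodeAt_inj hl.le (Nat.zero_le _) he.2
    subst this
    exact hne rfl
  · intro hn
    refine absurd ?_ hn
    rw [Finset.mem_filter]
    exact ⟨Finset.mem_univ _, by rw [origin_eq, nodeAt_eq_src hpos]⟩

lemma inflow_succ (hf : f.IsFeasible I) {j : J} {k : ℕ} (hk : k + 1 < (I.path j).length) :
    ∀ᵐ θ, f.inflow j (I.path j)[k + 1] θ = f.outflow j (I.path j)[k] θ := by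
  have hin : ∀ᵐ θ, ∀ e, e ∉ I.path j → f.inflow j e θ = 0 :=
    ae_all_iff.2 fun e => by
      by_cases h : e ∈ I.path j
      · simp [h]
      · filter_upwards [hf.in_off_path j e h] with θ hθ _ using hθ
  have hout : ∀ᵐ θ, ∀ e, e ∉ I.path j → f.outflow j e θ = 0 :=
    ae_all_iff.2 fun e => by
      by_cases h : e ∈ I.path j
      · simp [h]
      · filter_upwards [hf.out_off_path j e h] with θ hθ _ using hθ
  filter_upwards [hf.conservation j (I.nodeAt j (k + 1)), hin, hout] with θ hc hi ho
  rcases lt_or_ge θ 0 with h0 | h0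
  · rw [hf.in_neg_time _ _ _ h0, hf.out_neg_time _ _ _ h0]
  have h := (hc h0).1
    (by rw [origin_eq]; intro h; exact absurd (nodeAt_inj hk.le (Nat.zero_le _) h) (by omega))
    (by rw [dest_eq]; intro h; exact absurd (nodeAt_inj hk.le le_rfl h) (by omega))
  have hk' : k < (I.path j).length := by omega
  rw [Finset.sum_eq_single (I.path j)[k + 1], Finset.sum_eq_single (I.path j)[k], sub_eq_zero] at h
  · exact h
  · intro e he hne
    refine ho e fun hmem => ?_
    obtain ⟨l, hl, rfl⟩ := List.getElem_of_mem hmem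
    rw [Finset.mem_filter, ← nodeAt_succ hl] at he
    have := nodeAt_inj (by omega) (by omega) he.2
    obtain rfl : l = k := by omega
    exact hne rfl
  · intro hn
    refine absurd ?_ hn
    rw [Finset.mem_filter]
    exact ⟨Finset.mem_univ _, by rw [nodeAt_succ hk']⟩
  · intro e he hne
    refine hi e fun hmem => ?_
    obtain ⟨l, hl, rfl⟩ := List.getElem_of_mem hmem
    rw [Finset.mem_filter, ← nodeAt_eq_src hl] at he
    have := nodeAt_inj (by omega) (by omega) he.2
    subst this
    exact hne rfl
  · intro hn
    refine absurd ?_ hn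
    rw [Finset.mem_filter]
    exact ⟨Finset.mem_univ _, by rw [nodeAt_eq_src hk]⟩

lemma inVol_first (hf : f.IsFeasible I) (j : J) {θ : ℝ} (hθ : 0 ≤ θ) :
    f.inVol j ((I.path j)[0]'(I.length_path_pos j)) θ = I.cumSupply j θ := by
  unfold inVol cumSupply
  refine intervalIntegral.integral_congr_ae ?_
  filter_upwards [hf.inflow_first j] with x hx hmem
  rw [Set.uIoc_of_le hθ] at hmem
  exact hx hmem.1.le

lemma inVol_succ (hf : f.IsFeasible I) {j : J} {k : ℕ} (hk : k + 1 < (I.path j).length) (θ : ℝ) :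
    f.inVol j (I.path j)[k + 1] θ = f.outVol j (I.path j)[k] θ := by
  unfold inVol outVol
  refine intervalIntegral.integral_congr_ae ?_
  filter_upwards [hf.inflow_succ hk] with x hx _ using hx

lemma inVol_of_nonpos (hf : f.IsFeasible I) (j : J) (e : E) {θ : ℝ} (h : θ ≤ 0) :
    f.inVol j e θ = 0 :=
  integral_eq_zero_of_neg_time (hf.in_neg_time j e) h

lemma inVol_off_path (hf : f.IsFeasible I) {j : J} {e : E} (h : e ∉ I.path j) (θ : ℝ) :
    f.inVol j e θ = 0 := by
  refine intervalIntegral.integral_zero_ae ?_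
  filter_upwards [hf.in_off_path j e h] with x hx _ using hx

lemma continuous_inVol (hf : f.IsFeasible I) (j : J) (e : E) : Continuous (f.inVol j e) :=
  intervalIntegral.continuous_primitive (hf.inflow_intervalIntegrable j e) 0

/-- The entry time of every particle is well defined. -/
lemma isLeast_entrySet (hf : f.IsFeasible I) {j : J} {φ : ℝ} (h0 : 0 ≤ φ) (hm : φ ≤ I.mass j) :
    IsLeast (I.entrySet j φ) (sInf (I.entrySet j φ)) := by
  have hpos := I.length_path_pos j
  have heq : I.entrySet j φ = Set.Ici 0 ∩ f.inVol j (I.path j)[0] ⁻¹' {φ} := by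
    ext θ
    refine and_congr_right fun hθ => ?_
    rw [Set.mem_preimage, Set.mem_singleton_iff, hf.inVol_first j hθ]
  have hclosed : IsClosed (I.entrySet j φ) := by
    rw [heq]
    exact isClosed_Ici.inter (isClosed_singleton.preimage (hf.continuous_inVol _ _))
  have hne : (I.entrySet j φ).Nonempty := by
    obtain ⟨b, hb, hbm⟩ := I.exists_cumSupply_eq_mass j
    have := intermediate_value_Icc hb (hf.continuous_inVol j (I.path j)[0]).continuousOn
    obtain ⟨θ, hθ, h⟩ := this (a := φ) ⟨by rwa [hf.inVol_of_nonpos _ _ le_rfl], by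
      rwa [hf.inVol_first j hb, hbm b le_rfl]⟩
    rw [heq]
    exact ⟨θ, hθ.1, h⟩
  have hbdd : BddBelow (I.entrySet j φ) := ⟨0, fun θ hθ => hθ.1⟩
  exact ⟨hclosed.csInf_mem hne hbdd, fun θ hθ => csInf_le hbdd hθ⟩

/-- The arrival time of the particle `φ` at a node is the first time when the volume `φ` has
reached that node. -/
lemma arrivalAt_spec (hf : f.IsFeasible I) {j : J} {φ : ℝ} (h0 : 0 < φ) (hm : φ ≤ I.mass j) {k : ℕ}
    (hk : k < (I.path j).length) :
    0 ≤ I.arrivalAt f j φ k ∧ f.inVol j (I.path j)[k] (I.arrivalAt f j φ k) = φ ∧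
      ∀ θ < I.arrivalAt f j φ k, f.inVol j (I.path j)[k] θ < φ := by
  induction k with
  | zero =>
    obtain ⟨hmem, hleast⟩ := hf.isLeast_entrySet h0.le hm
    rw [arrivalAt_zero]
    refine ⟨hmem.1, by rw [hf.inVol_first j hmem.1]; exact hmem.2, fun θ hθ => ?_⟩
    rcases lt_or_ge θ 0 with hneg | hpos
    · rwa [hf.inVol_of_nonpos _ _ hneg.le]
    · refine lt_of_le_of_ne ?_ fun h => ?_
      · refine (hf.inVol_mono j _ hθ.le).trans ?_
        rw [hf.inVol_first j hmem.1]; exact hmem.2.le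
      · rw [hf.inVol_first j hpos] at h
        exact absurd (hleast ⟨hpos, h⟩) (not_le.2 hθ)
  | succ k ih =>
    have hk' : k < (I.path j).length := by omega
    obtain ⟨h1, h2, h3⟩ := ih hk'
    rw [arrivalAt_succ f φ hk']
    set e := (I.path j)[k]
    refine ⟨?_, ?_, fun θ hθ => ?_⟩
    · have := hf.add_le_exitTime e (I.arrivalAt f j φ k)
      linarith [I.τ_pos e]
    · rw [hf.inVol_succ hk, hf.outVol_exitTime, h2]
    · obtain ⟨ϑ, hgal, hT⟩ := hf.exists_entryTime e
      rw [hf.inVol_succ hk, ← hT θ, hf.outVol_exitTime]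
      refine h3 _ ?_
      by_contra! hle
      have := hf.exitTime_mono e hle
      rw [hT] at this
      linarith

lemma arrivalAt_succ_ge (hf : f.IsFeasible I) {j : J} (φ : ℝ) {k : ℕ} (hk : k < (I.path j).length) :
    I.arrivalAt f j φ k + I.τ (I.path j)[k] ≤ I.arrivalAt f j φ (k + 1) := by
  rw [arrivalAt_succ f φ hk]
  exact hf.add_le_exitTime _ _

lemma arrivalAt_le_last (hf : f.IsFeasible I) {j : J} (φ : ℝ) {k : ℕ}
    (hk : k ≤ (I.path j).length) :
    I.arrivalAt f j φ k ≤ I.arrivalAt f j φ (I.path j).length := by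
  obtain ⟨n, hn⟩ := Nat.exists_eq_add_of_le hk
  induction n generalizing k with
  | zero => rw [hn, add_zero]
  | succ n ih =>
    have hk' : k < (I.path j).length := by omega
    have := hf.arrivalAt_succ_ge φ hk'
    linarith [I.τ_pos (I.path j)[k], ih hk' (by omega)]

lemma arrivalAt_mono (hf : f.IsFeasible I) {j : J} {φ ψ : ℝ} (h0 : 0 < φ) (hφ : φ ≤ ψ)
    (hm : ψ ≤ I.mass j) {k : ℕ} (hk : k ≤ (I.path j).length) :
    I.arrivalAt f j φ k ≤ I.arrivalAt f j ψ k := by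
  induction k with
  | zero =>
    have hpos := I.length_path_pos j
    obtain ⟨-, -, h3⟩ := hf.arrivalAt_spec h0 (hφ.trans hm) hpos
    obtain ⟨-, h2, -⟩ := hf.arrivalAt_spec (h0.trans_le hφ) hm hpos
    by_contra! h
    linarith [h3 _ h]
  | succ k ih =>
    rw [arrivalAt_succ f φ hk, arrivalAt_succ f ψ hk]
    exact hf.exitTime_mono _ (ih (by omega))

lemma arrivalAt_le_horizon (hf : f.IsFeasible I) {j : J} {φ : ℝ} (h0 : 0 < φ) (hm : φ ≤ I.mass j)
    {k : ℕ} (hk : k ≤ (I.path j).length) : I.arrivalAt f j φ k ≤ I.horizon f := by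
  refine (hf.arrivalAt_mono h0 hm le_rfl hk).trans ((hf.arrivalAt_le_last _ hk).trans ?_)
  rw [← arrival_nodeAt f _ le_rfl, ← dest_eq]
  exact le_ciSup (f := fun j => I.arrival f j (I.dest j) (I.mass j)) (Set.finite_range _).bddAbove j

/-- The inflow rates are bounded independently of the flow. -/
lemma _root_.LoadingInstance.exists_inflow_bound (I : LoadingInstance V E J) :
    ∃ B : ℝ, 0 ≤ B ∧ ∀ f : FlowRates E J, f.IsFeasible I → ∀ j e a b, a ≤ b →
      f.inVol j e b - f.inVol j e a ≤ B * (b - a) := by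
  choose b hb using I.u_bounded
  have hb0 : ∀ j, 0 ≤ b j := fun j => (I.u_nonneg j 0 le_rfl).trans (hb j 0 le_rfl)
  -- Inflow into the first arc of a path is supply, bounded by some `b j`; inflow into a later arc
  -- is outflow of its predecessor, bounded by a capacity.
  refine ⟨∑ j, b j + ∑ e, I.ν e, add_nonneg (Finset.sum_nonneg fun j _ => hb0 j)
    (Finset.sum_nonneg fun e _ => (I.ν_pos e).le), fun f hf j e x y hxy => ?_⟩
  have hbj : b j ≤ ∑ j, b j := Finset.single_le_sum (fun j _ => hb0 j) (Finset.mem_univ j)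
  have hνe : ∀ e, I.ν e ≤ ∑ e, I.ν e := fun e =>
    Finset.single_le_sum (fun e _ => (I.ν_pos e).le) (Finset.mem_univ e)
  have hν0 : 0 ≤ ∑ e, I.ν e := Finset.sum_nonneg fun e _ => (I.ν_pos e).le
  have hs0 : 0 ≤ ∑ j, b j := Finset.sum_nonneg fun j _ => hb0 j
  have hle : ∀ᵐ θ, f.inflow j e θ ≤ ∑ j, b j + ∑ e, I.ν e := by
    by_cases hmem : e ∈ I.path j
    · obtain ⟨k, hk, rfl⟩ := List.getElem_of_mem hmem
      cases k with
      | zero =>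
        filter_upwards [hf.inflow_first j] with θ h
        rcases lt_or_ge θ 0 with h0 | h0
        · rw [hf.in_neg_time _ _ _ h0]; positivity
        · rw [h h0]; linarith [hb j θ h0]
      | succ k =>
        filter_upwards [hf.inflow_succ hk, hf.outflow_le j (I.path j)[k]] with θ h h'
        rw [h]
        linarith [hνe (I.path j)[k]]
    · filter_upwards [hf.in_off_path j e hmem] with θ h
      rw [h]; positivity
  rw [hf.inVol_sub]
  refine (intervalIntegral.integral_mono_ae hxy (hf.inflow_intervalIntegrable j e _ _)
    intervalIntegrable_const hle).trans ?_
  rw [intervalIntegral.integral_const, smul_eq_mul, mul_comm]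

end FlowRates.IsFeasible

/-! ### A discrete queue with carried-over capacity -/

/-- Recursion of the number `n t` of packets that have left an arc before step `t`, where `A t`
packets have entered it before step `t`. -/
structure IsQueueRecursion (A n : ℕ → ℕ) (cap : ℕ → ℝ) (τ : ℕ) (ν : ℝ) : Prop where
  mono : Monotone A
  entered_zero : A 0 = 0
  left_zero : n 0 = 0
  cap_nonneg : 0 ≤ ν
  -- In step `t` the buffer holds what entered before step `t + 1 - τ` and has not left. Truncated
  -- subtraction is harmless: it yields `A 0 = 0` while nothing can have crossed the arc.
  left_succ : ∀ t, n (t + 1) = n t + min ⌊cap t⌋₊ (A (t + 1 - τ) - n t)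
  cap_zero : cap 0 = ν
  cap_succ : ∀ t, cap (t + 1) =
    if ((A (t + 1 - τ) - n t : ℕ) : ℝ) ≤ cap t then ν else ν + cap t - ⌊cap t⌋₊

namespace IsQueueRecursion

variable {A n : ℕ → ℕ} {cap : ℕ → ℝ} {τ : ℕ} {ν : ℝ}

lemma le_cap (h : IsQueueRecursion A n cap τ ν) (t : ℕ) : ν ≤ cap t := by
  induction t with
  | zero => exact h.cap_zero.ge
  | succ t ih =>
    rw [h.cap_succ]
    split_ifs
    · exact le_rfl
    · linarith [Nat.floor_le (h.cap_nonneg.trans ih)]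

lemma cap_le (h : IsQueueRecursion A n cap τ ν) (t : ℕ) : cap t ≤ ν + 1 := by
  cases t with
  | zero => linarith [h.cap_zero]
  | succ t =>
    rw [h.cap_succ]
    split_ifs
    · linarith
    · linarith [Nat.lt_floor_add_one (cap t)]

lemma left_le (h : IsQueueRecursion A n cap τ ν) (t : ℕ) : n t ≤ A (t - τ) := by
  induction t with
  | zero => simp [h.left_zero]
  | succ t ih =>
    have := h.mono (show t - τ ≤ t + 1 - τ by omega)
    have := h.left_succ t
    omega

lemma left_mono (h : IsQueueRecursion A n cap τ ν) : Monotone n :=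
  monotone_nat_of_le_succ fun t => by rw [h.left_succ]; omega

lemma left_le_left_add (h : IsQueueRecursion A n cap τ ν) {s t : ℕ} (hst : s ≤ t) :
    (n t : ℝ) ≤ n s + ν * (t - s) + 1 := by
  -- Packets sent are paid for by the current capacity, and at most the remainder is carried over,
  -- so this potential never grows. The bonus `cap t - ν` lies in [0, 1], which is the additive
  -- error of one packet.
  have hanti : Antitone fun t : ℕ => (n t : ℝ) - ν * t + (cap t - ν) := by
    refine antitone_nat_of_succ_le fun t => ?_
    have h1 : (n (t + 1) : ℝ) ≤ n t + ⌊cap t⌋₊ := by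
      rw [h.left_succ]
      push_cast
      linarith [min_le_left (⌊cap t⌋₊ : ℝ) ((A (t + 1 - τ) - n t : ℕ) : ℝ)]
    have h2 : cap (t + 1) ≤ ν + cap t - ⌊cap t⌋₊ := by
      rw [h.cap_succ]
      split_ifs
      · linarith [Nat.floor_le (h.cap_nonneg.trans (h.le_cap t))]
      · exact le_rfl
    push_cast
    linarith
  have := hanti hst
  simp only at this
  linarith [h.le_cap t, h.cap_le s]

/-- The discrete counterpart of `exists_exitTime_eq`. Here `s` is the last moment when the buffer
was emptied; afterwards the full integral capacity is used in every step and the potential of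
`left_le_left_add` is conserved. -/
lemma exists_le_left (h : IsQueueRecursion A n cap τ ν) (t : ℕ) :
    ∃ s ≤ t, A (s - τ) ≤ n t ∧ (A (s - τ) : ℝ) + ν * (t - s) - (cap t - ν) ≤ n t := by
  induction t with
  | zero => exact ⟨0, le_rfl, by simp [h.entered_zero], by simp [h.entered_zero, h.cap_zero, h.left_zero]⟩
  | succ t ih =>
    by_cases hb : ((A (t + 1 - τ) - n t : ℕ) : ℝ) ≤ cap t
    · have h1 : n (t + 1) = A (t + 1 - τ) := by
        have := Nat.le_floor hb
        have := h.left_succ t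
        have := h.left_le t
        have := h.mono (show t - τ ≤ t + 1 - τ by omega)
        omega
      refine ⟨t + 1, le_rfl, h1.ge, ?_⟩
      rw [h1, h.cap_succ, if_pos hb]
      simp
    · obtain ⟨s, hs, h1, h2⟩ := ih
      refine ⟨s, by omega, h1.trans (h.left_mono (Nat.le_succ t)), ?_⟩
      have h3 : n (t + 1) = n t + ⌊cap t⌋₊ := by
        have h4 : ⌊cap t⌋₊ < A (t + 1 - τ) - n t :=
          (Nat.floor_lt (h.cap_nonneg.trans (h.le_cap t))).2 (not_le.1 hb)
        rw [h.left_succ, min_eq_left h4.le]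
      rw [h3, h.cap_succ, if_neg hb]
      push_cast
      linarith

/-- Upper bound on the exit step `t₁` of a packet that enters in step `t₀`. -/
lemma exists_exit_le (h : IsQueueRecursion A n cap τ ν) {t₀ t₁ : ℕ} (hlt : n t₁ < A (t₀ + 1)) :
    ∃ r ≤ t₀, ν * (t₁ - r - τ) ≤ A (t₀ + 1) - A r + 1 := by
  obtain ⟨s, -, h1, h2⟩ := h.exists_le_left t₁
  have hs : s - τ ≤ t₀ := by
    by_contra! hcon
    have := h.mono (show t₀ + 1 ≤ s - τ by omega)
    omega
  refine ⟨s - τ, hs, ?_⟩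
  have h3 : (s : ℝ) ≤ (s - τ : ℕ) + τ := by
    exact_mod_cast (by omega : s ≤ s - τ + τ)
  have h4 : (n t₁ : ℝ) < A (t₀ + 1) := by exact_mod_cast hlt
  have h5 : ν * (t₁ - (s - τ : ℕ) - τ) ≤ ν * (t₁ - s) :=
    mul_le_mul_of_nonneg_left (by linarith) h.cap_nonneg
  linarith [h.cap_le t₁]

lemma transit_le_exit (h : IsQueueRecursion A n cap τ ν) {t₀ t₁ : ℕ} (hlt : A t₀ < n (t₁ + 1)) :
    t₀ + τ ≤ t₁ := by
  have h1 := h.left_le (t₁ + 1)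
  by_contra! hcon
  have := h.mono (show t₁ + 1 - τ ≤ t₀ by omega)
  omega

/-- Lower bound on the exit step `t₁` of a packet that enters in step `t₀`. -/
lemma le_exit (h : IsQueueRecursion A n cap τ ν) {t₀ t₁ : ℕ} (hlt : A t₀ < n (t₁ + 1)) {r : ℕ}
    (hr : r ≤ t₀ + 1) : (A t₀ : ℝ) - A r ≤ ν * (t₁ + 1 - r - τ) + 1 := by
  have h0 := h.transit_le_exit hlt
  have h1 := h.left_le_left_add (show r + τ ≤ t₁ + 1 by omega)
  have h2 : (n (r + τ) : ℝ) ≤ A r := by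
    have := h.left_le (r + τ)
    rw [Nat.add_sub_cancel] at this
    exact_mod_cast this
  have h3 : (A t₀ : ℝ) < n (t₁ + 1) := by exact_mod_cast hlt
  push_cast at h1
  have : ν * ((t₁ : ℝ) + 1 - (r + τ)) = ν * (t₁ + 1 - r - τ) := by ring
  linarith

lemma exists_left_ge (h : IsQueueRecursion A n cap τ ν) (hν : 0 < ν) (t₀ : ℕ) :
    ∃ t, A t₀ ≤ n t := by
  by_contra! hcon
  obtain ⟨t, ht⟩ := exists_nat_gt (t₀ + τ + (A (t₀ + 1) + 1) / ν)
  have hmono : (A t₀ : ℕ) ≤ A (t₀ + 1) := h.mono (Nat.le_succ _)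
  obtain ⟨r, hr, h1⟩ := h.exists_exit_le ((hcon t).trans_le hmono)
  have h2 : (A (t₀ + 1) + 1 : ℝ) / ν < t - r - τ := by
    have : (r : ℝ) ≤ t₀ := by exact_mod_cast hr
    linarith
  rw [div_lt_iff₀ hν] at h2
  have h3 : (0 : ℝ) ≤ A r := by positivity
  linarith

end IsQueueRecursion

/-! ### Packet routing -/

namespace PacketRouting

variable {E P : Type*} [Fintype E] [DecidableEq E] (R : PacketRouting E P)

/-- Merging only interleaves the lists: the iteration bound equals the number of remaining packets,
and the rule always picks a nonempty source. Nothing else about merging enters the proof. -/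
lemma countP_mergeLoop (q : P → Bool) (t : ℕ) (e : E) (y : Option E → ℕ) (n : ℕ)
    (Y : Option E → List P) (a : Option E → ℚ) (hn : ∑ s, (Y s).length = n) :
    (R.mergeLoop t e y n Y a).countP q = ∑ s, (Y s).countP q := by
  induction n generalizing Y a with
  | zero =>
    have h : ∀ s, Y s = [] := fun s => by
      have := (Finset.sum_eq_zero_iff.1 hn) s (Finset.mem_univ s)
      exact List.length_eq_zero_iff.1 this
    simp [mergeLoop, h]
  | succ n ih =>
    simp only [mergeLoop]
    set A : Finset (Option E) := {s | (Y s).length ≠ 0} with hA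
    set S : Finset (Option E) := {s ∈ A | ∀ s' ∈ A, a s ≤ a s'} with hS
    have hAne : A.Nonempty := by
      by_contra hcon
      rw [Finset.not_nonempty_iff_eq_empty, hA, Finset.filter_eq_empty_iff] at hcon
      rw [Finset.sum_eq_zero fun s _ => not_not.1 (hcon (Finset.mem_univ s))] at hn
      omega
    have hSne : S.Nonempty := by
      obtain ⟨s, hs, hmin⟩ := A.exists_min_image a hAne
      exact ⟨s, by rw [hS, Finset.mem_filter]; exact ⟨hs, hmin⟩⟩
    have hmem := R.tie.pick_mem t e Y S hSne
    set s := R.tie.pick t e Y S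
    have hsA : (Y s).length ≠ 0 := by
      have := (Finset.mem_filter.1 hmem).1
      rw [hA, Finset.mem_filter] at this
      exact this.2
    cases hY : Y s with
    | nil => simp [hY] at hsA
    | cons p ps =>
      -- Removing the head of one list changes one summand. This serves both for the length, to keep
      -- the iteration bound exact, and for the count.
      have hrest : ∀ g : List P → ℕ, ∑ x, g (Function.update Y s ps x) + g (p :: ps) =
          ∑ x, g (Y x) + g ps := fun g => by
        rw [← Finset.add_sum_erase _ _ (Finset.mem_univ s),
          ← Finset.add_sum_erase _ (fun x => g (Y x)) (Finset.mem_univ s), Function.update_self, hY]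
        rw [Finset.sum_congr rfl fun x hx => by rw [Function.update_of_ne (Finset.ne_of_mem_erase hx)]]
        omega
      have h1 := hrest List.length
      have h2 := hrest (List.countP q)
      rw [List.length_cons] at h1
      rw [List.countP_cons] at h2
      simp only
      rw [List.countP_cons, ih _ _ (by omega)]
      omega

lemma countP_merge (q : P → Bool) (t : ℕ) (e : E) (Y : Option E → List P) :
    (R.merge t e Y).countP q = ∑ s, (Y s).countP q :=
  R.countP_mergeLoop q t e _ _ Y _ rfl

/-- The packets that entered `e` before step `t`, labelled with the step of their entry. -/
noncomputable def entered (e : E) : ℕ → List (P × ℕ)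
  | 0 => []
  | t + 1 => entered e t ++ (R.entering t e).map (fun p => (p, t))

/-- The number of packets that left `e` before step `t`. -/
noncomputable def numLeft (e : E) (t : ℕ) : ℕ := ∑ s ∈ Finset.range t, (R.leaving s e).length

/-- The number of packets with property `q` that entered `e` before step `t`. -/
noncomputable def enteredCount (q : P → Bool) (e : E) (t : ℕ) : ℕ :=
  ∑ s ∈ Finset.range t, (R.entering s e).countP q

/-- The number of packets with property `q` that left `e` before step `t`. -/
noncomputable def leftCount (q : P → Bool) (e : E) (t : ℕ) : ℕ :=
  ∑ s ∈ Finset.range t, (R.leaving s e).countP q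

variable {R}

lemma exists_entered_eq_append (e : E) {u t : ℕ} (h : u ≤ t) :
    ∃ l, R.entered e t = R.entered e u ++ l ∧ ∀ x ∈ l, u ≤ x.2 := by
  induction t, h using Nat.le_induction with
  | base => exact ⟨[], by simp, by simp⟩
  | succ t hut ih =>
    obtain ⟨l, hl, hx⟩ := ih
    refine ⟨l ++ (R.entering t e).map (fun p => (p, t)), by rw [entered, hl, List.append_assoc], ?_⟩
    intro x hmem
    rcases List.mem_append.1 hmem with h | h
    · exact hx x h
    · obtain ⟨p, -, rfl⟩ := List.mem_map.1 h
      exact hut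

lemma lt_of_mem_entered {e : E} {t : ℕ} {x : P × ℕ} (h : x ∈ R.entered e t) : x.2 < t := by
  induction t with
  | zero => simp [entered] at h
  | succ t ih =>
    rcases List.mem_append.1 h with h | h
    · exact (ih h).trans (Nat.lt_succ_self t)
    · obtain ⟨p, -, rfl⟩ := List.mem_map.1 h
      exact Nat.lt_succ_self t

lemma length_entered_mono (e : E) : Monotone fun t => (R.entered e t).length :=
  monotone_nat_of_le_succ fun t => by simp [entered]

lemma enteredCount_eq (q : P → Bool) (e : E) (t : ℕ) :
    R.enteredCount q e t = (R.entered e t).countP (fun x => q x.1) := by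
  unfold enteredCount
  induction t with
  | zero => simp [entered]
  | succ t ih =>
    rw [Finset.sum_range_succ, ih, entered, List.countP_append, List.countP_map]
    rfl

/-- The entry list is sorted by entry step, so `takeWhile` cuts it exactly at the packets that
entered before step `t + 1 - tauHat`. -/
lemma buffer_eq_of {e : E} {t : ℕ} (hτ : 1 ≤ R.tauHat e)
    (hq : (R.state t).queue e = (R.entered e t).drop (R.numLeft e t))
    (hle : R.numLeft e t ≤ (R.entered e (t + 1 - R.tauHat e)).length) :
    R.buffer (R.state t) t e = (R.entered e (t + 1 - R.tauHat e)).drop (R.numLeft e t) := by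
  obtain ⟨l, hl, hx⟩ := R.exists_entered_eq_append e (show t + 1 - R.tauHat e ≤ t by omega)
  unfold buffer
  rw [hq, hl, List.drop_append_of_le_length hle, List.takeWhile_append_of_pos]
  · convert List.append_nil _
    cases l with
    | nil => rfl
    | cons x l =>
      have := hx x (by simp)
      rw [List.takeWhile_cons_of_neg]
      simp only [decide_eq_true_eq]
      omega
  · intro x hmem
    have := R.lt_of_mem_entered (List.mem_of_mem_drop hmem)
    simp only [decide_eq_true_eq]
    omega

/-- The FIFO invariant: the packets that have left form a prefix of the entry list, and that prefix
entered at least `tauHat` steps earlier. -/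
lemma state_queue {e : E} (hτ : 1 ≤ R.tauHat e) (t : ℕ) :
    (R.state t).queue e = (R.entered e t).drop (R.numLeft e t) ∧
      R.numLeft e t ≤ (R.entered e (t - R.tauHat e)).length := by
  induction t with
  | zero => simp [state, entered, numLeft]
  | succ t ih =>
    obtain ⟨hq, hle⟩ := ih
    have hle1 : R.numLeft e t ≤ (R.entered e (t + 1 - R.tauHat e)).length :=
      hle.trans (length_entered_mono e (by omega))
    have hb := buffer_eq_of hτ hq hle1
    have hlen : (R.leaving t e).length ≤
        (R.entered e (t + 1 - R.tauHat e)).length - R.numLeft e t := by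
      rw [leaving, leavingOf, hb, List.length_map, List.length_take, List.length_drop]
      exact min_le_right _ _
    have hsucc : R.numLeft e (t + 1) = R.numLeft e t + (R.leaving t e).length :=
      Finset.sum_range_succ _ _
    refine ⟨?_, by omega⟩
    have hle2 := R.length_entered_mono e (show t + 1 - R.tauHat e ≤ t by omega)
    simp only at hle2
    rw [entered, List.drop_append_of_le_length (by omega), hsucc, ← List.drop_drop, ← hq]
    rfl

lemma buffer_eq {e : E} (hτ : 1 ≤ R.tauHat e) (t : ℕ) :
    R.buffer (R.state t) t e = (R.entered e (t + 1 - R.tauHat e)).drop (R.numLeft e t) := by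
  obtain ⟨hq, hle⟩ := R.state_queue hτ t
  exact buffer_eq_of hτ hq (hle.trans (length_entered_mono e (by omega)))

/-- The loading of a single arc is a queue with carried-over capacity. -/
lemma isQueueRecursion {e : E} (hτ : 1 ≤ R.tauHat e) (hν : 0 ≤ R.nuHat e) :
    IsQueueRecursion (fun t => (R.entered e t).length) (R.numLeft e) (fun t => (R.state t).cap e)
      (R.tauHat e) (R.nuHat e) where
  mono := length_entered_mono e
  entered_zero := rfl
  left_zero := rfl
  cap_nonneg := hν
  left_succ t := by
    have : R.numLeft e (t + 1) = R.numLeft e t + (R.leaving t e).length :=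
      Finset.sum_range_succ _ _
    rw [this, leaving, leavingOf, buffer_eq hτ, List.length_map, List.length_take,
      List.length_drop]
  cap_zero := rfl
  cap_succ t := by
    simp only [state, step]
    rw [buffer_eq hτ, List.length_drop]

lemma leftCount_eq (q : P → Bool) {e : E} (hτ : 1 ≤ R.tauHat e) (t : ℕ) :
    R.leftCount q e t = ((R.entered e t).take (R.numLeft e t)).countP (fun x => q x.1) := by
  unfold leftCount
  induction t with
  | zero => simp [entered]
  | succ t ih =>
    have hsucc : R.numLeft e (t + 1) = R.numLeft e t + (R.leaving t e).length :=
      Finset.sum_range_succ _ _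
    have hle1 := (R.state_queue hτ t).2
    have hle2 := (R.state_queue hτ (t + 1)).2
    have hle3 := length_entered_mono (R := R) e (show t - R.tauHat e ≤ t + 1 - R.tauHat e by omega)
    simp only at hle3
    obtain ⟨l, hl, -⟩ := R.exists_entered_eq_append e (show t + 1 - R.tauHat e ≤ t by omega)
    obtain ⟨l', hl', -⟩ := R.exists_entered_eq_append e (show t + 1 - R.tauHat e ≤ t + 1 by omega)
    have hleav : R.leaving t e = (((R.entered e (t + 1 - R.tauHat e)).drop (R.numLeft e t)).take
        (R.leaving t e).length).map Prod.fst := by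
      have : R.leaving t e = (((R.entered e (t + 1 - R.tauHat e)).drop (R.numLeft e t)).take
        ⌊(R.state t).cap e⌋₊).map Prod.fst := by
        rw [leaving, leavingOf, buffer_eq hτ]
      rw [this, List.length_map, List.length_take, ← List.take_eq_take_min]
    rw [Finset.sum_range_succ, ih, hl', List.take_append_of_le_length hle2, hsucc, List.take_add,
      List.countP_append, hl, List.take_append_of_le_length (by omega)]
    congr 1
    conv_lhs => rw [hleav]
    rw [List.countP_map]
    rfl

lemma take_numLeft_eq {e : E} (hτ : 1 ≤ R.tauHat e) {t M : ℕ} (h : t ≤ M) :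
    (R.entered e t).take (R.numLeft e t) = (R.entered e M).take (R.numLeft e t) := by
  obtain ⟨l, hl, -⟩ := R.exists_entered_eq_append e h
  have := (R.state_queue hτ t).2.trans (length_entered_mono e (show t - R.tauHat e ≤ t by omega))
  rw [hl, List.take_append_of_le_length this]

lemma entered_eq_take (e : E) {t M : ℕ} (h : t ≤ M) :
    R.entered e t = (R.entered e M).take (R.entered e t).length := by
  obtain ⟨l, hl, -⟩ := R.exists_entered_eq_append e h
  rw [hl, List.take_left']
  rfl

/-- What has entered and what has left are prefixes of one list, so comparing total numbers compares
the numbers of each commodity. With `leftCount_le_enteredCount` this plays the role of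
`outVol_exitTime` for packets. -/
lemma enteredCount_le_leftCount (q : P → Bool) {e : E} (hτ : 1 ≤ R.tauHat e) {s t : ℕ}
    (h : (R.entered e s).length ≤ R.numLeft e t) : R.enteredCount q e s ≤ R.leftCount q e t := by
  rw [leftCount_eq q hτ, enteredCount_eq, take_numLeft_eq hτ (le_max_right s t),
    entered_eq_take e (le_max_left s t)]
  exact (List.take_sublist_take_left h).countP_le

lemma leftCount_le_enteredCount (q : P → Bool) {e : E} (hτ : 1 ≤ R.tauHat e) {s t : ℕ}
    (h : R.numLeft e t ≤ (R.entered e s).length) : R.leftCount q e t ≤ R.enteredCount q e s := by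
  rw [leftCount_eq q hτ, enteredCount_eq, take_numLeft_eq hτ (le_max_right s t),
    entered_eq_take e (le_max_left s t)]
  exact (List.take_sublist_take_left h).countP_le

end PacketRouting

/-! ### Refined arrival times -/

section StepFunctions

variable {α β : ℝ} (c : ℕ → ℕ)

/-- Cumulative volume of packets of size `β`, `c t` of which arrive during time step `t`. -/
noncomputable def stepVolume (α β : ℝ) (c : ℕ → ℕ) (θ : ℝ) : ℝ :=
  ∫ ξ in (0 : ℝ)..θ, β / α * c ⌈ξ / α⌉₊

lemma intervalIntegrable_step (hα : 0 < α) (a b : ℝ) :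
    IntervalIntegrable (fun ξ => β / α * (c ⌈ξ / α⌉₊ : ℝ)) volume a b := by
  have hmeas : Measurable fun ξ : ℝ => β / α * (c ⌈ξ / α⌉₊ : ℝ) :=
    ((measurable_from_nat (f := fun n => (c n : ℝ))).comp
      (Nat.measurable_ceil.comp (measurable_id.div_const α))).const_mul _
  refine IntegrableOn.intervalIntegrable ?_
  refine Measure.integrableOn_of_bounded (M := |β / α| *
    ((∑ s ∈ Finset.range (⌈max a b / α⌉₊ + 1), c s : ℕ) : ℝ))
    isCompact_uIcc.measure_lt_top.ne hmeas.aestronglyMeasurable ?_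
  filter_upwards [ae_restrict_mem measurableSet_uIcc] with ξ hξ
  rw [norm_mul, Real.norm_eq_abs, Real.norm_of_nonneg (Nat.cast_nonneg _)]
  refine mul_le_mul_of_nonneg_left ?_ (abs_nonneg _)
  have hle : ⌈ξ / α⌉₊ ≤ ⌈max a b / α⌉₊ :=
    Nat.ceil_le_ceil (div_le_div_of_nonneg_right hξ.2 hα.le)
  exact_mod_cast Finset.single_le_sum (f := c) (fun _ _ => Nat.zero_le _)
    (Finset.mem_range.2 (Nat.lt_succ_of_le hle))

variable {c}

/-- Step `t` occupies the interval ((t - 1)α, tα], so steps 0 to `t` end at time `t * α`. Step 0 has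
no extent in positive time, whence the assumption `c 0 = 0`. -/
lemma stepVolume_mul (hα : 0 < α) (h0 : c 0 = 0) (t : ℕ) :
    stepVolume α β c (t * α) = β * (∑ s ∈ Finset.range (t + 1), c s : ℕ) := by
  unfold stepVolume
  induction t with
  | zero => simp [h0]
  | succ t ih =>
    rw [← intervalIntegral.integral_add_adjacent_intervals
      (intervalIntegrable_step c hα 0 (t * α)) (intervalIntegrable_step c hα _ _), ih,
      Finset.sum_range_succ _ (t + 1)]
    have : ∫ ξ in (t * α)..((t + 1 : ℕ) * α), β / α * (c ⌈ξ / α⌉₊ : ℝ) =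
        ∫ ξ in (t * α)..((t + 1 : ℕ) * α), β / α * (c (t + 1) : ℝ) := by
      refine intervalIntegral.integral_congr_ae (Filter.Eventually.of_forall fun ξ hξ => ?_)
      rw [Set.uIoc_of_le (by push_cast; nlinarith)] at hξ
      have : ⌈ξ / α⌉₊ = t + 1 := by
        rw [Nat.ceil_eq_iff (Nat.succ_ne_zero t)]
        constructor
        · rw [lt_div_iff₀ hα]; simpa using hξ.1
        · rw [div_le_iff₀ hα]; exact hξ.2
      rw [this]
    rw [this, intervalIntegral.integral_const, smul_eq_mul]
    push_cast
    field_simp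
    ring

lemma stepVolume_mono (hα : 0 < α) (hβ : 0 < β) : Monotone (stepVolume α β c) := by
  intro a b hab
  unfold stepVolume
  rw [← sub_nonneg, intervalIntegral.integral_interval_sub_left (intervalIntegrable_step c hα _ _)
    (intervalIntegrable_step c hα _ _)]
  exact intervalIntegral.integral_nonneg hab fun ξ _ => by positivity

/-- The first time at which the volume `i * β` has arrived lies in the step in which the `i`-th
packet arrives. -/
lemma exists_step_of_isLeast (hα : 0 < α) (hβ : 0 < β) (h0 : c 0 = 0) {i : ℕ} (hi : 1 ≤ i)
    (hex : ∃ t, i ≤ ∑ s ∈ Finset.range t, c s) :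
    IsLeast {θ | 0 ≤ θ ∧ i * β ≤ stepVolume α β c θ}
      (sInf {θ | 0 ≤ θ ∧ i * β ≤ stepVolume α β c θ}) ∧
    ∃ t : ℕ, 1 ≤ t ∧ ∑ s ∈ Finset.range t, c s < i ∧ i ≤ ∑ s ∈ Finset.range (t + 1), c s ∧
      ((t : ℝ) - 1) * α < sInf {θ | 0 ≤ θ ∧ i * β ≤ stepVolume α β c θ} ∧
      sInf {θ | 0 ≤ θ ∧ i * β ≤ stepVolume α β c θ} ≤ t * α := by
  obtain ⟨t, ht1, ht, ht'⟩ : ∃ t : ℕ, 1 ≤ t ∧ ∑ s ∈ Finset.range t, c s < i ∧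
      i ≤ ∑ s ∈ Finset.range (t + 1), c s := by
    have hspec := Nat.find_spec hex
    have hmin := fun {m} => Nat.find_min hex (m := m)
    -- As `c 0 = 0` and `i ≥ 1`, the sums over `range 0` and `range 1` are too small.
    obtain ⟨t, ht⟩ : ∃ t, Nat.find hex = t + 2 := by
      refine ⟨Nat.find hex - 2, ?_⟩
      rcases hT : Nat.find hex with _ | _ | t
      · rw [hT] at hspec; simp at hspec; omega
      · rw [hT] at hspec; simp [h0] at hspec; omega
      · omega
    exact ⟨t + 1, by omega, not_le.1 (hmin (by omega)), ht ▸ hspec⟩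
  set S := {θ | 0 ≤ θ ∧ i * β ≤ stepVolume α β c θ} with hS
  have hcont : Continuous (stepVolume α β c) :=
    intervalIntegral.continuous_primitive (fun a b => intervalIntegrable_step c hα a b) 0
  have hmem : (t : ℝ) * α ∈ S := by
    refine ⟨by positivity, ?_⟩
    rw [stepVolume_mul hα h0, mul_comm]
    exact mul_le_mul_of_nonneg_left (by exact_mod_cast ht') hβ.le
  have hbdd : BddBelow S := ⟨0, fun θ hθ => hθ.1⟩
  have hclosed : IsClosed S := isClosed_Ici.inter (isClosed_le continuous_const hcont)
  have hleast : IsLeast S (sInf S) :=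
    ⟨hclosed.csInf_mem ⟨_, hmem⟩ hbdd, fun θ hθ => csInf_le hbdd hθ⟩
  refine ⟨hleast, t, ht1, ht, ht', ?_, hleast.2 hmem⟩
  by_contra! hle
  have h1 := hleast.1.2.trans (stepVolume_mono (c := c) hα hβ hle)
  have h2 : ((t : ℝ) - 1) = ((t - 1 : ℕ) : ℝ) := by push_cast [ht1]; ring
  rw [h2, stepVolume_mul hα h0, Nat.sub_add_cancel ht1, mul_comm] at h1
  have h3 := le_of_mul_le_mul_left h1 hβ
  have h4 : i ≤ ∑ s ∈ Finset.range t, c s := by exact_mod_cast h3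
  omega

end StepFunctions

lemma length_eq_sum_countP_fst {J : Type*} [Fintype J] [DecidableEq J] {M : Type*} (l : List (J × M)) :
    l.length = ∑ j, l.countP (fun p => p.1 = j) := by
  induction l with
  | nil => simp
  | cons p l ih =>
    simp only [List.length_cons, List.countP_cons, Finset.sum_add_distrib, ← ih]
    simp

lemma pair_infix_iff {E : Type*} {p : List E} {a b : E} :
    [a, b] <:+: p ↔ ∃ k, ∃ h : k + 1 < p.length, p[k] = a ∧ p[k + 1] = b := by
  constructor
  · rintro ⟨s, t, rfl⟩
    exact ⟨s.length, by simp, by simp, by simp⟩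
  · rintro ⟨k, h, rfl, rfl⟩
    refine ⟨p.take k, p.drop (k + 2), ?_⟩
    have h1 : p.drop k = p[k] :: p[k + 1] :: p.drop (k + 2) := by
      rw [List.drop_eq_getElem_cons (by omega), List.drop_eq_getElem_cons h]
    calc p.take k ++ [p[k], p[k + 1]] ++ p.drop (k + 2) = p.take k ++ p.drop k := by
          rw [h1]; simp
      _ = p := List.take_append_drop k p

lemma countP_lt_succ {P : Type*} (l : List P) (q : P → Prop) [DecidablePred q] (g : P → ℕ) (t : ℕ) :
    l.countP (fun p => q p ∧ g p < t + 1) =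
      l.countP (fun p => q p ∧ g p < t) + l.countP (fun p => q p ∧ g p = t) := by
  induction l with
  | nil => simp
  | cons p l ih =>
    simp only [List.countP_cons, ih, decide_eq_true_eq]
    by_cases hq : q p
    · rcases lt_trichotomy (g p) t with h | h | h
      · simp [hq, h, h.ne, h.trans (Nat.lt_succ_self t)]; omega
      · simp [hq, h]; omega
      · simp [hq, h.ne', h.not_gt, show ¬ g p < t + 1 by omega]
    · simp [hq]

/-! ### Counting the packets of a commodity -/

namespace LoadingInstance

variable {V E J : Type*} {I : LoadingInstance V E J} {α β : ℝ} {L : List (J × ℕ)}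
  {tie : TieRule E (J × ℕ)}

/-- Cumulative supply is monotone and reaches the total mass, so the set of admissible release steps
is nonempty and upward closed. -/
lemma release_le_iff (hα : 0 < α) {j : J} {i s : ℕ} (hi : i * β ≤ I.mass j) :
    (I.induced α β L tie).release (j, i) ≤ s ↔ i * β ≤ I.cumSupply j (s * α) := by
  have hne : {t : ℕ | i * β ≤ I.cumSupply j (t * α)}.Nonempty := by
    obtain ⟨b, -, hbm⟩ := I.exists_cumSupply_eq_mass j
    refine ⟨⌈b / α⌉₊, ?_⟩
    rw [Set.mem_ofPred_eq, hbm]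
    · exact hi
    · have := Nat.le_ceil (b / α)
      rwa [div_le_iff₀ hα] at this
  constructor
  · intro h
    have h1 : i * β ≤ I.cumSupply j (((I.induced α β L tie).release (j, i) : ℕ) * α) :=
      Nat.sInf_mem hne
    refine h1.trans (cumSupply_mono (by positivity) ?_)
    exact mul_le_mul_of_nonneg_right (by exact_mod_cast h) hα.le
  · exact fun h => Nat.sInf_le h

lemma natCast_mul_le_mass (hβ : 0 < β) {j : J} {i : ℕ} (hi : i ≤ ⌊I.mass j / β⌋₊) :
    i * β ≤ I.mass j := by
  have h0 : 0 ≤ I.mass j := by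
    have := I.cumSupply_le_mass (j := j) le_rfl
    rwa [cumSupply_zero] at this
  have h1 := Nat.floor_le (div_nonneg h0 hβ.le)
  have h2 : (i : ℝ) ≤ ⌊I.mass j / β⌋₊ := by exact_mod_cast hi
  rw [← le_div_iff₀ hβ]
  exact h2.trans h1

lemma one_le_tauHat (hα : 0 < α) (e : E) : 1 ≤ (I.induced α β L tie).tauHat e :=
  Nat.one_le_iff_ne_zero.2 (Nat.ceil_pos.2 (div_pos (I.τ_pos e) hα)).ne'

lemma nuHat_pos (hα : 0 < α) (hβ : 0 < β) (e : E) : 0 < (I.induced α β L tie).nuHat e :=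
  div_pos (mul_pos (I.ν_pos e) hα) hβ

lemma induced_isQueueRecursion [Fintype E] [DecidableEq E] (hα : 0 < α) (hβ : 0 < β) (e : E) :
    IsQueueRecursion (fun t => ((I.induced α β L tie).entered e t).length)
      ((I.induced α β L tie).numLeft e) (fun t => ((I.induced α β L tie).state t).cap e)
      ⌈I.τ e / α⌉₊ (I.ν e * α / β) :=
  PacketRouting.isQueueRecursion (one_le_tauHat hα e) (nuHat_pos hα hβ e).le

end LoadingInstance

lemma LoadingInstance.head?_path {V E J : Type*} {I : LoadingInstance V E J} (j : J) :
    (I.path j).head? = some ((I.path j)[0]'(I.length_path_pos j)) := by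
  rw [List.head?_eq_getElem?, List.getElem?_eq_getElem]

lemma LoadingInstance.IsPacketList.countP_eq {V E J : Type*} [DecidableEq J]
    {I : LoadingInstance V E J} {β : ℝ} {L : List (J × ℕ)} (hL : I.IsPacketList β L) (j : J)
    (Q : J × ℕ → Prop) [DecidablePred Q] :
    L.countP (fun p => p.1 = j ∧ Q p) =
      ((Finset.Icc 1 ⌊I.mass j / β⌋₊).filter (fun i => Q (j, i))).card := by
  have hnd : L.Nodup := hL.1.imp fun {p q} h hpq => by
    subst hpq; exact absurd (h rfl) (lt_irrefl _)
  rw [List.countP_eq_length_filter, ← List.toFinset_card_of_nodup (hnd.filter _),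
    ← Finset.card_image_of_injective ((Finset.Icc 1 ⌊I.mass j / β⌋₊).filter (fun i => Q (j, i)))
      (Prod.mk_right_injective j)]
  refine congrArg Finset.card ?_
  ext ⟨j', i⟩
  simp only [List.mem_toFinset, List.mem_filter, decide_eq_true_eq, Finset.mem_image,
    Finset.mem_filter, Finset.mem_Icc, Prod.mk.injEq]
  constructor
  · rintro ⟨h1, rfl, h2⟩
    exact ⟨i, ⟨(hL.2 _ _).1 h1, h2⟩, rfl, rfl⟩
  · rintro ⟨i', ⟨h1, h2⟩, rfl, rfl⟩
    exact ⟨(hL.2 _ _).2 h1, rfl, h2⟩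

/-! ### Packet counts along the path of a commodity. -/

namespace LoadingInstance

variable {V E J : Type*} [Fintype E] [DecidableEq E] [DecidableEq J]
  {I : LoadingInstance V E J} {α β : ℝ} {L : List (J × ℕ)} {tie : TieRule E (J × ℕ)}

lemma countP_entering (t : ℕ) (e : E) (j : J) :
    ((I.induced α β L tie).entering t e).countP (fun p => p.1 = j) =
      (if (I.path j).head? = some e then
        L.countP (fun p => p.1 = j ∧ (I.induced α β L tie).release p = t) else 0) +
      ∑ e', if [e', e] <:+: I.path j then
        ((I.induced α β L tie).leaving t e').countP (fun p => p.1 = j) else 0 := by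
  rw [PacketRouting.entering, PacketRouting.enteringOf, PacketRouting.countP_merge,
    Fintype.sum_option]
  congr 1
  · rw [PacketRouting.wanting, List.countP_filter]
    split_ifs with h
    · refine List.countP_congr fun p _ => ?_
      simp only [Bool.and_eq_true, decide_eq_true_eq]
      constructor
      · rintro ⟨h1, h2, -⟩; exact ⟨h1, h2⟩
      · rintro ⟨rfl, h2⟩; exact ⟨rfl, h2, h⟩
    · rw [List.countP_eq_zero]
      rintro p - hp
      simp only [Bool.and_eq_true, decide_eq_true_eq] at hp
      obtain ⟨rfl, -, h2⟩ := hp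
      exact h h2
  · refine Finset.sum_congr rfl fun e' _ => ?_
    rw [PacketRouting.wanting, List.countP_filter]
    split_ifs with h
    · refine List.countP_congr fun p _ => ?_
      simp only [Bool.and_eq_true, decide_eq_true_eq]
      constructor
      · rintro ⟨h1, -⟩; exact h1
      · rintro rfl; exact ⟨rfl, h⟩
    · rw [List.countP_eq_zero]
      rintro p - hp
      simp only [Bool.and_eq_true, decide_eq_true_eq] at hp
      obtain ⟨rfl, h2⟩ := hp
      exact h h2

lemma countP_entering_first (t : ℕ) (j : J) :
    ((I.induced α β L tie).entering t ((I.path j)[0]'(I.length_path_pos j))).countP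
      (fun p => p.1 = j) =
      L.countP (fun p => p.1 = j ∧ (I.induced α β L tie).release p = t) := by
  rw [countP_entering, if_pos (head?_path j), Finset.sum_eq_zero, add_zero]
  intro e' _
  rw [if_neg]
  rw [pair_infix_iff]
  rintro ⟨k, hk, -, h⟩
  exact absurd (path_getElem_inj hk _ h) (by omega)

lemma countP_entering_succ (t : ℕ) {j : J} {k : ℕ} (hk : k + 1 < (I.path j).length) :
    ((I.induced α β L tie).entering t (I.path j)[k + 1]).countP (fun p => p.1 = j) =
      ((I.induced α β L tie).leaving t (I.path j)[k]).countP (fun p => p.1 = j) := by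
  rw [countP_entering, if_neg, zero_add, Finset.sum_eq_single (I.path j)[k], if_pos]
  · exact pair_infix_iff.2 ⟨k, hk, rfl, rfl⟩
  · intro e' _ hne
    rw [if_neg]
    rw [pair_infix_iff]
    rintro ⟨l, hl, rfl, h⟩
    have := path_getElem_inj hl hk h
    obtain rfl : l = k := by omega
    exact hne rfl
  · intro h; exact absurd (Finset.mem_univ _) h
  · rw [head?_path]
    intro h
    exact absurd (path_getElem_inj _ hk (Option.some.inj h)) (by omega)

lemma countP_entering_off_path (t : ℕ) {j : J} {e : E} (he : e ∉ I.path j) :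
    ((I.induced α β L tie).entering t e).countP (fun p => p.1 = j) = 0 := by
  rw [countP_entering, if_neg, zero_add, Finset.sum_eq_zero]
  · intro e' _
    rw [if_neg]
    rw [pair_infix_iff]
    rintro ⟨l, hl, -, rfl⟩
    exact he (List.getElem_mem _)
  · rw [head?_path]
    intro h
    exact he (Option.some.inj h ▸ List.getElem_mem _)

variable (I α β L tie) in
/-- Number of packets of commodity `j` that entered `e` before step `t`. -/
noncomputable def numIn (j : J) (e : E) (t : ℕ) : ℕ :=
  (I.induced α β L tie).enteredCount (fun p => p.1 = j) e t

variable (I α β L tie) in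
/-- Number of packets of commodity `j` that left `e` before step `t`. -/
noncomputable def numOut (j : J) (e : E) (t : ℕ) : ℕ :=
  (I.induced α β L tie).leftCount (fun p => p.1 = j) e t

lemma numIn_off_path {j : J} {e : E} (he : e ∉ I.path j) (t : ℕ) :
    I.numIn α β L tie j e t = 0 := by
  unfold numIn PacketRouting.enteredCount
  exact Finset.sum_eq_zero fun s _ => countP_entering_off_path s he

lemma numIn_succ {j : J} {k : ℕ} (hk : k + 1 < (I.path j).length) (t : ℕ) :
    I.numIn α β L tie j (I.path j)[k + 1] t = I.numOut α β L tie j (I.path j)[k] t := by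
  unfold numIn numOut PacketRouting.enteredCount PacketRouting.leftCount
  exact Finset.sum_congr rfl fun s _ => countP_entering_succ s hk

lemma length_entered_eq_sum [Fintype J] (e : E) (t : ℕ) :
    ((I.induced α β L tie).entered e t).length = ∑ j, I.numIn α β L tie j e t := by
  unfold numIn
  simp only [PacketRouting.enteredCount_eq]
  have := length_eq_sum_countP_fst (((I.induced α β L tie).entered e t).map Prod.fst)
  rw [List.length_map] at this
  rw [this]
  refine Finset.sum_congr rfl fun j _ => ?_
  rw [List.countP_map]
  rfl

lemma numIn_first (j : J) (t : ℕ) :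
    I.numIn α β L tie j ((I.path j)[0]'(I.length_path_pos j)) t =
      L.countP (fun p => p.1 = j ∧ (I.induced α β L tie).release p < t) := by
  unfold numIn PacketRouting.enteredCount
  simp only [countP_entering_first]
  induction t with
  | zero => symm; rw [Finset.sum_range_zero, List.countP_eq_zero]; simp
  | succ t ih =>
    rw [Finset.sum_range_succ, ih, countP_lt_succ]

/-- Packet `i` has entered its first arc by step `s` if and only if the corresponding volume has been
supplied by then. -/
lemma le_numIn_first_iff (hα : 0 < α) (hβ : 0 < β) (hL : I.IsPacketList β L) {j : J} {i s : ℕ}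
    (hi1 : 1 ≤ i) (hi : i ≤ ⌊I.mass j / β⌋₊) :
    i ≤ I.numIn α β L tie j ((I.path j)[0]'(I.length_path_pos j)) (s + 1) ↔
      i * β ≤ I.cumSupply j (s * α) := by
  rw [numIn_first, hL.countP_eq j (fun p => (I.induced α β L tie).release p < s + 1)]
  constructor
  · intro h
    by_contra hcon
    -- The released packets of a commodity form an initial segment of the indices, so if at least
    -- `i` of them are released then packet `i` is among them.
    have hsub : (Finset.Icc 1 ⌊I.mass j / β⌋₊).filter
        (fun i => (I.induced α β L tie).release (j, i) < s + 1) ⊆ Finset.Icc 1 (i - 1) := by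
      intro i' hi'
      rw [Finset.mem_filter, Finset.mem_Icc, Nat.lt_succ_iff] at hi'
      rw [release_le_iff hα (natCast_mul_le_mass hβ hi'.1.2)] at hi'
      rw [Finset.mem_Icc]
      refine ⟨hi'.1.1, ?_⟩
      by_contra! hlt
      refine hcon (le_trans ?_ hi'.2)
      exact mul_le_mul_of_nonneg_right (by exact_mod_cast (by omega : i ≤ i')) hβ.le
    have := Finset.card_le_card hsub
    rw [Nat.card_Icc] at this
    omega
  · intro h
    have hsub : Finset.Icc 1 i ⊆ (Finset.Icc 1 ⌊I.mass j / β⌋₊).filter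
        (fun i => (I.induced α β L tie).release (j, i) < s + 1) := by
      intro i' hi'
      rw [Finset.mem_Icc] at hi'
      have hle : i' ≤ ⌊I.mass j / β⌋₊ := hi'.2.trans hi
      rw [Finset.mem_filter, Finset.mem_Icc, Nat.lt_succ_iff,
        release_le_iff hα (natCast_mul_le_mass hβ hle)]
      refine ⟨⟨hi'.1, hle⟩, le_trans ?_ h⟩
      exact mul_le_mul_of_nonneg_right (by exact_mod_cast hi'.2) hβ.le
    have := Finset.card_le_card hsub
    rw [Nat.card_Icc] at this
    omega

lemma numIn_first_le (hL : I.IsPacketList β L) (j : J) (t : ℕ) :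
    I.numIn α β L tie j ((I.path j)[0]'(I.length_path_pos j)) t ≤ ⌊I.mass j / β⌋₊ := by
  rw [numIn_first, hL.countP_eq j (fun p => (I.induced α β L tie).release p < t)]
  refine (Finset.card_filter_le _ _).trans ?_
  simp

lemma numOut_le_numIn (hα : 0 < α) (hβ : 0 < β) (j : J) (e : E) (t : ℕ) :
    I.numOut α β L tie j e t ≤ I.numIn α β L tie j e (t - ⌈I.τ e / α⌉₊) :=
  PacketRouting.leftCount_le_enteredCount _ (one_le_tauHat hα e)
    ((induced_isQueueRecursion hα hβ e).left_le t)

lemma numIn_mono (j : J) (e : E) : Monotone (I.numIn α β L tie j e) :=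
  monotone_nat_of_le_succ fun t => by
    unfold numIn PacketRouting.enteredCount
    rw [Finset.sum_range_succ]; omega

lemma numIn_le (hα : 0 < α) (hβ : 0 < β) (hL : I.IsPacketList β L) {j : J} {k : ℕ}
    (hk : k < (I.path j).length) (t : ℕ) :
    I.numIn α β L tie j (I.path j)[k] t ≤ ⌊I.mass j / β⌋₊ := by
  induction k with
  | zero => exact numIn_first_le hL j t
  | succ k ih =>
    rw [numIn_succ hk]
    exact (numOut_le_numIn hα hβ j _ t).trans ((numIn_mono j _ (Nat.sub_le _ _)).trans (ih (by omega)))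

/-- Nothing moves in step 0, as the discrete transit time is at least one step. This and `numIn_one`
provide the condition `c 0 = 0` for the step functions. -/
lemma numOut_one (hα : 0 < α) (hβ : 0 < β) (j : J) (e : E) : I.numOut α β L tie j e 1 = 0 := by
  have h := numOut_le_numIn (I := I) (L := L) (tie := tie) hα hβ j e 1
  have h1 : 1 ≤ ⌈I.τ e / α⌉₊ := one_le_tauHat (L := L) (tie := tie) (β := β) hα e
  rw [Nat.sub_eq_zero_of_le h1] at h
  simpa [numIn, PacketRouting.enteredCount] using h

lemma numIn_one (hα : 0 < α) (hβ : 0 < β) (hL : I.IsPacketList β L) {j : J} {k : ℕ}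
    (hk : k < (I.path j).length) : I.numIn α β L tie j (I.path j)[k] 1 = 0 := by
  cases k with
  | zero =>
    by_contra hne
    have h1 := numIn_first_le (α := α) (tie := tie) hL j 1
    have h2 := (le_numIn_first_iff (tie := tie) (s := 0) (i := 1) (j := j) hα hβ hL le_rfl
      (by omega)).1 (by rw [zero_add]; omega)
    simp [cumSupply_zero] at h2
    linarith
  | succ k => rw [numIn_succ hk, numOut_one hα hβ]

lemma exists_le_numOut (hα : 0 < α) (hβ : 0 < β) {j : J} {e : E} {i : ℕ}
    (h : ∃ t, i ≤ I.numIn α β L tie j e t) : ∃ t, i ≤ I.numOut α β L tie j e t := by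
  obtain ⟨t, ht⟩ := h
  obtain ⟨t', ht'⟩ := (induced_isQueueRecursion (I := I) (L := L) (tie := tie) hα hβ e).exists_left_ge
    (nuHat_pos (I := I) (L := L) (tie := tie) hα hβ e) t
  exact ⟨t', ht.trans (PacketRouting.enteredCount_le_leftCount _ (one_le_tauHat hα e) ht')⟩

/-- Every packet eventually enters every arc of its path. -/
lemma exists_le_numIn (hα : 0 < α) (hβ : 0 < β) (hL : I.IsPacketList β L) {j : J} {i : ℕ}
    (hi1 : 1 ≤ i) (hi : i ≤ ⌊I.mass j / β⌋₊) {k : ℕ} (hk : k < (I.path j).length) :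
    ∃ t, i ≤ I.numIn α β L tie j (I.path j)[k] t := by
  induction k with
  | zero =>
    refine ⟨(I.induced α β L tie).release (j, i) + 1, ?_⟩
    rw [le_numIn_first_iff hα hβ hL hi1 hi]
    exact (release_le_iff hα (natCast_mul_le_mass hβ hi)).1 le_rfl
  | succ k ih =>
    obtain ⟨t, ht⟩ := exists_le_numOut hα hβ (ih (by omega))
    exact ⟨t, by rwa [numIn_succ hk]⟩

variable [DecidableEq V]

lemma cumAt_succ {j : J} {k : ℕ} (hk : k < (I.path j).length) :
    I.cumAt (I.induced α β L tie) α β j (I.nodeAt j (k + 1)) =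
      stepVolume α β (fun t => ((I.induced α β L tie).leaving t (I.path j)[k]).countP
        (fun p => p.1 = j)) := by
  unfold cumAt
  rw [find?_nodeAt_succ hk]
  rfl

lemma cumAt_eq {j : J} {k : ℕ} (hk : k < (I.path j).length) :
    I.cumAt (I.induced α β L tie) α β j (I.nodeAt j k) =
      stepVolume α β (fun t => ((I.induced α β L tie).entering t (I.path j)[k]).countP
        (fun p => p.1 = j)) := by
  cases k with
  | zero =>
    unfold cumAt
    rw [find?_nodeAt_zero, List.head_eq_getElem]
    rfl
  | succ k =>
    rw [cumAt_succ (by omega)]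
    simp only [countP_entering_succ _ hk]

/-- The refined arrival time at the tail of an arc and the step of entering that arc. -/
lemma refinedArrival_entry (hα : 0 < α) (hβ : 0 < β) (hL : I.IsPacketList β L) {j : J} {i : ℕ}
    (hi1 : 1 ≤ i) (hi : i ≤ ⌊I.mass j / β⌋₊) {k : ℕ} (hk : k < (I.path j).length) :
    IsLeast (I.refinedSet (I.induced α β L tie) α β j (I.nodeAt j k) i)
      (I.refinedArrival (I.induced α β L tie) α β j (I.nodeAt j k) i) ∧
    ∃ t : ℕ, 1 ≤ t ∧ I.numIn α β L tie j (I.path j)[k] t < i ∧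
      i ≤ I.numIn α β L tie j (I.path j)[k] (t + 1) ∧
      ((t : ℝ) - 1) * α < I.refinedArrival (I.induced α β L tie) α β j (I.nodeAt j k) i ∧
      I.refinedArrival (I.induced α β L tie) α β j (I.nodeAt j k) i ≤ t * α := by
  unfold refinedArrival refinedSet
  rw [cumAt_eq hk]
  refine exists_step_of_isLeast hα hβ ?_ hi1 (exists_le_numIn hα hβ hL hi1 hi hk)
  have := numIn_one (tie := tie) hα hβ hL hk
  unfold numIn PacketRouting.enteredCount at this
  rwa [Finset.sum_range_one] at this

/-- The refined arrival time at the head of an arc and the step of leaving that arc. -/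
lemma refinedArrival_exit (hα : 0 < α) (hβ : 0 < β) (hL : I.IsPacketList β L) {j : J} {i : ℕ}
    (hi1 : 1 ≤ i) (hi : i ≤ ⌊I.mass j / β⌋₊) {k : ℕ} (hk : k < (I.path j).length) :
    IsLeast (I.refinedSet (I.induced α β L tie) α β j (I.nodeAt j (k + 1)) i)
      (I.refinedArrival (I.induced α β L tie) α β j (I.nodeAt j (k + 1)) i) ∧
    ∃ t : ℕ, 1 ≤ t ∧ I.numOut α β L tie j (I.path j)[k] t < i ∧
      i ≤ I.numOut α β L tie j (I.path j)[k] (t + 1) ∧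
      ((t : ℝ) - 1) * α < I.refinedArrival (I.induced α β L tie) α β j (I.nodeAt j (k + 1)) i ∧
      I.refinedArrival (I.induced α β L tie) α β j (I.nodeAt j (k + 1)) i ≤ t * α := by
  unfold refinedArrival refinedSet
  rw [cumAt_succ hk]
  refine exists_step_of_isLeast hα hβ ?_ hi1
    (exists_le_numOut hα hβ (exists_le_numIn hα hβ hL hi1 hi hk))
  have := numOut_one (I := I) (L := L) (tie := tie) hα hβ j (I.path j)[k]
  unfold numOut PacketRouting.leftCount at this
  rwa [Finset.sum_range_one] at this

end LoadingInstance

/-! ### Comparison of the two models -/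

namespace FlowRates.IsFeasible

open LoadingInstance

variable {V E J : Type*} [Fintype J] [DecidableEq V] [Fintype E] {I : LoadingInstance V E J}
  {f : FlowRates E J}

lemma inVol_le_mass (hf : f.IsFeasible I) {j : J} {k : ℕ} (hk : k < (I.path j).length) (θ : ℝ) :
    f.inVol j (I.path j)[k] θ ≤ I.mass j := by
  induction k generalizing θ with
  | zero =>
    rcases le_total 0 θ with h | h
    · rw [hf.inVol_first j h]; exact cumSupply_le_mass h
    · rw [hf.inVol_of_nonpos _ _ h, ← I.cumSupply_zero j]; exact cumSupply_le_mass le_rfl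
  | succ k ih =>
    obtain ⟨ϑ, -, hT⟩ := hf.exists_entryTime (I.path j)[k]
    rw [hf.inVol_succ hk, ← hT θ, hf.outVol_exitTime]
    exact ih _ _

/-- Comparison of the exit times of a particle and a packet that enter an arc at almost the same
time, provided that the cumulative inflows are close to each other up to then. -/
lemma abs_exitTime_sub_le (hf : f.IsFeasible I) {e : E} {A n : ℕ → ℕ} {cap : ℕ → ℝ} {α β B ε η : ℝ}
    (hα : 0 < α) (hβ : 0 < β)
    (hq : IsQueueRecursion A n cap ⌈I.τ e / α⌉₊ (I.ν e * α / β))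
    (hB : ∀ a b, a ≤ b → f.cumIn e b - f.cumIn e a ≤ B * (b - a)) {t₀ t₁ : ℕ} (ht₀ : 1 ≤ t₀)
    (hη : ∀ r ≤ t₀ + 1, |f.cumIn e (((r : ℝ) - 1) * α) - β * A r| ≤ η)
    (hlo : A t₀ < n (t₁ + 1)) (hhi : n t₁ < A (t₀ + 1)) {x d d' : ℝ} (hx : 0 ≤ x)
    (hd : ((t₀ : ℝ) - 1) * α < d ∧ d ≤ t₀ * α) (hd' : ((t₁ : ℝ) - 1) * α < d' ∧ d' ≤ t₁ * α)
    (hε : |x - d| ≤ ε) :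
    |f.exitTime I.toNetwork e x - d'| ≤ ε + 2 * α + (B * (ε + α) + 2 * η + β) / I.ν e := by
  have hν := I.ν_pos e
  have hε0 : 0 ≤ ε := (abs_nonneg _).trans hε
  obtain ⟨hε1, hε2⟩ := abs_le.1 hε
  have hτ1 : I.τ e ≤ ⌈I.τ e / α⌉₊ * α := by
    have := Nat.le_ceil (I.τ e / α)
    rwa [div_le_iff₀ hα] at this
  have hτ2 : ⌈I.τ e / α⌉₊ * α ≤ I.τ e + α := by
    have := (Nat.ceil_lt_add_one (div_pos (I.τ_pos e) hα).le).le
    have := mul_le_mul_of_nonneg_right this hα.le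
    rwa [add_mul, div_mul_cancel₀ _ hα.ne', one_mul] at this
  -- Error budget: B(ε + α) for the shift between the two entry times, 2η for comparing the inflow
  -- curves at two points, β for the packet of carried-over capacity, and ε + 2α for rounding times
  -- to steps. Since `A r` counts the steps before `r`, it is compared with the flow at time (r -
  -- 1)α.
  have hshift : ∀ a b, b ≤ a + (ε + α) → f.cumIn e b ≤ f.cumIn e a + B * (ε + α) := fun a b hab => by
    have h1 := hf.cumIn_mono e hab
    have h2 := hB a (a + (ε + α)) (by linarith)
    rw [add_sub_cancel_left] at h2
    linarith
  have hscale : ∀ y : ℝ, β * (I.ν e * α / β * y) = I.ν e * (y * α) := fun y => by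
    field_simp
  rw [abs_le]
  constructor
  -- The packet is not much later than the particle: the last emptying of the packet buffer gives a
  -- competitor `s` in the maximum formula for the flow. It is capped at `x` because only earlier
  -- inflow counts; the cap costs at most `ε`.
  · obtain ⟨r, hr, hle⟩ := hq.exists_exit_le hhi
    have hle := mul_le_mul_of_nonneg_left hle hβ.le
    rw [hscale] at hle
    have h1 := abs_le.1 (hη (t₀ + 1) le_rfl)
    have h2 := abs_le.1 (hη r (by omega))
    push_cast at h1
    rw [add_sub_cancel_right] at h1
    set s := min (((r : ℝ) - 1) * α) x
    have h3 := hf.cumIn_mono e (min_le_left (((r : ℝ) - 1) * α) x)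
    have h4 := hshift x (t₀ * α) (by linarith [hd.1])
    have hrt : ((r : ℝ) - 1) * α ≤ (t₀ - 1) * α :=
      mul_le_mul_of_nonneg_right (by linarith [(by exact_mod_cast hr : (r : ℝ) ≤ t₀)]) hα.le
    have h5 : ((r : ℝ) - 1) * α ≤ s + ε := by
      rcases min_choice (((r : ℝ) - 1) * α) x with h | h <;> simp only [s, h] <;> linarith [hd.1]
    have h6 := hf.div_le_exitTime_sub e (min_le_right (((r : ℝ) - 1) * α) x)
    have h7 := hf.add_le_exitTime e s
    have h8 : ((t₁ : ℝ) - r - ⌈I.τ e / α⌉₊) * α ≤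
        (f.cumIn e x - f.cumIn e s) / I.ν e + (B * (ε + α) + 2 * η + β) / I.ν e := by
      rw [← add_div, le_div_iff₀ hν, mul_comm]
      linarith
    linarith [hd'.2]
  -- The particle is not much later than the packet: the flow's maximizing time `s` is rounded down
  -- to a step boundary (r - 1)α. Since `s` may exceed the entry step of the packet by up to `ε`,
  -- `r` is capped at `t₀`.
  · obtain ⟨s, hs0, hsx, hT⟩ := hf.exists_exitTime_eq e hx
    set r := min (⌊s / α⌋₊ + 1) t₀ with hr
    have hr1 : 1 ≤ r := le_min (Nat.le_add_left _ _) ht₀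
    have hle := hq.le_exit hlo (r := r) ((min_le_right _ _).trans (Nat.le_succ _))
    have hle := mul_le_mul_of_nonneg_left hle hβ.le
    rw [mul_add, hscale] at hle
    have h1 := abs_le.1 (hη t₀ (Nat.le_succ _))
    have h2 := abs_le.1 (hη r ((min_le_right _ _).trans (Nat.le_succ _)))
    have h3 : ((r : ℝ) - 1) * α ≤ s := by
      have : (r : ℝ) ≤ ⌊s / α⌋₊ + 1 := by exact_mod_cast min_le_left _ _
      have h4 : (r : ℝ) - 1 ≤ s / α := by
        linarith [Nat.floor_le (div_nonneg hs0 hα.le)]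
      rwa [le_div_iff₀ hα] at h4
    have h4 : s ≤ ((r : ℝ) - 1) * α + α + ε := by
      rcases min_choice (⌊s / α⌋₊ + 1) t₀ with h | h
      · have h5 := (Nat.lt_floor_add_one (s / α)).le
        rw [div_le_iff₀ hα] at h5
        rw [hr, h]
        push_cast
        linarith
      · rw [hr, h]
        linarith [hd.2]
    have h5 := hf.cumIn_mono e h3
    have h6 := hshift (((t₀ : ℝ) - 1) * α) x (by linarith [hd.2])
    have h7 : (f.cumIn e x - f.cumIn e s) / I.ν e ≤
        ((t₁ : ℝ) + 1 - r - ⌈I.τ e / α⌉₊) * α + (B * (ε + α) + 2 * η + β) / I.ν e := by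
      rw [← sub_le_iff_le_add, ← sub_div, div_le_iff₀ hν, mul_comm _ (I.ν e)]
      linarith
    linarith [hd'.1]

end FlowRates.IsFeasible

/-! ### Propagation of the error along arcs and through time. -/

namespace LoadingInstance

variable {V E J : Type*} [Fintype J] [DecidableEq V] [Fintype E] [DecidableEq E] [DecidableEq J]
  {I : LoadingInstance V E J} {f : FlowRates E J} {α β : ℝ} {L : List (J × ℕ)}
  {tie : TieRule E (J × ℕ)}

variable (I f α β L tie) in
/-- The arrival times of particles and packets before time `Θ` differ by at most `ε`. -/
def ArrivalsClose (Θ ε : ℝ) : Prop :=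
  ∀ j, ∀ k ≤ (I.path j).length, ∀ i, 1 ≤ i → i ≤ ⌊I.mass j / β⌋₊ →
    (I.arrivalAt f j (i * β) k < Θ ∨
      I.refinedArrival (I.induced α β L tie) α β j (I.nodeAt j k) i < Θ) →
    |I.arrivalAt f j (i * β) k -
      I.refinedArrival (I.induced α β L tie) α β j (I.nodeAt j k) i| ≤ ε

/-- If `n` packets have entered by time (r - 1)α, then particle `nβ` is at most ε late and the
missing flow volume is at most Bε. If the flow were ahead by more than Bε + β, particle `(n + 1)β`
would precede its packet by more than ε. Only arrivals before Θ are involved. -/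
lemma ArrivalsClose.abs_inVol_sub_le {Θ ε B : ℝ} (h : I.ArrivalsClose f α β L tie Θ ε)
    (hf : f.IsFeasible I) (hα : 0 < α) (hβ : 0 < β) (hL : I.IsPacketList β L) (hε : 0 ≤ ε)
    (hB0 : 0 ≤ B) (hB : ∀ j e a b, a ≤ b → f.inVol j e b - f.inVol j e a ≤ B * (b - a))
    {j : J} {k : ℕ} (hk : k < (I.path j).length) {r : ℕ} (hr : ((r : ℝ) - 1) * α < Θ) :
    |f.inVol j (I.path j)[k] (((r : ℝ) - 1) * α) - β * I.numIn α β L tie j (I.path j)[k] r| ≤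
      B * ε + β := by
  have hBε : 0 ≤ B * ε := mul_nonneg hB0 hε
  rcases Nat.eq_zero_or_pos r with rfl | hr0
  · rw [hf.inVol_of_nonpos _ _ (by push_cast; linarith)]
    have : I.numIn α β L tie j (I.path j)[k] 0 = 0 := rfl
    rw [this]
    simp only [Nat.cast_zero, mul_zero, sub_zero, abs_zero]
    positivity
  set e := (I.path j)[k] with he
  set θ := ((r : ℝ) - 1) * α with hθ
  set n := I.numIn α β L tie j e r with hn
  have hshift : ∀ x, x ≤ θ + ε → f.inVol j e x ≤ f.inVol j e θ + B * ε := fun x hx => by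
    have h1 := hf.inVol_mono j e hx
    have h2 := hB j e θ (θ + ε) (by linarith)
    rw [add_sub_cancel_left] at h2
    linarith
  have hr1 : (1 : ℝ) ≤ r := by exact_mod_cast hr0
  have hθ0 : 0 ≤ θ := mul_nonneg (by linarith) hα.le
  rw [abs_le]
  constructor
  · rcases Nat.eq_zero_or_pos n with h0 | hpos
    · rw [h0]
      have := hf.inVol_mono j e hθ0
      rw [hf.inVol_of_nonpos j e le_rfl] at this
      push_cast
      linarith
    · have hnM : n ≤ ⌊I.mass j / β⌋₊ := numIn_le hα hβ hL hk r
      obtain ⟨-, t, -, ht, -, -, hd⟩ := refinedArrival_entry (tie := tie) hα hβ hL hpos hnM hk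
      have htr : t < r := by
        by_contra! hcon
        exact absurd (numIn_mono j e hcon) (not_le.2 ht)
      have htθ : (t : ℝ) * α ≤ θ := by
        have : (t : ℝ) + 1 ≤ r := by exact_mod_cast htr
        exact mul_le_mul_of_nonneg_right (by linarith) hα.le
      have hclose := abs_le.1 (h j k hk.le n hpos hnM (Or.inr (by linarith)))
      have hspec := (hf.arrivalAt_spec (mul_pos (Nat.cast_pos.2 hpos) hβ)
        (natCast_mul_le_mass hβ hnM) hk).2.1
      have := hshift _ (show I.arrivalAt f j (n * β) k ≤ θ + ε by linarith)
      linarith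
  · by_contra! hcon
    have hlt : ((n + 1 : ℕ) : ℝ) * β < f.inVol j e θ := by push_cast; linarith
    have hnM : n + 1 ≤ ⌊I.mass j / β⌋₊ := by
      refine Nat.le_floor ?_
      rw [le_div_iff₀ hβ]
      exact hlt.le.trans (hf.inVol_le_mass hk θ)
    obtain ⟨-, t, -, -, ht, hd, -⟩ :=
      refinedArrival_entry (tie := tie) hα hβ hL (Nat.le_add_left 1 n) hnM hk
    rw [← he] at ht
    have hrt : r ≤ t := by
      by_contra! hcon
      have := numIn_mono (I := I) (α := α) (β := β) (L := L) (tie := tie) j e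
        (show t + 1 ≤ r from hcon)
      omega
    have hspec := (hf.arrivalAt_spec (mul_pos (Nat.cast_pos.2 (Nat.succ_pos n)) hβ)
        (natCast_mul_le_mass hβ hnM) hk).2.1
    have hℓ : I.arrivalAt f j ((n + 1 : ℕ) * β) k < θ := by
      by_contra! hle
      have := hf.inVol_mono j e hle
      rw [hspec] at this
      linarith
    have hclose := abs_le.1 (h j k hk.le (n + 1) (Nat.le_add_left 1 n) hnM
      (Or.inl (hℓ.trans hr)))
    have hθt : θ ≤ ((t : ℝ) - 1) * α := by
      have : (r : ℝ) ≤ t := by exact_mod_cast hrt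
      exact mul_le_mul_of_nonneg_right (by linarith) hα.le
    have h1 := hf.inVol_mono j e (show θ ≤ I.arrivalAt f j ((n + 1 : ℕ) * β) k + ε by linarith)
    have h2 := hB j e _ (I.arrivalAt f j ((n + 1 : ℕ) * β) k + ε)
      (le_add_of_nonneg_right hε)
    rw [add_sub_cancel_left, hspec] at h2
    push_cast at h1 h2
    linarith

lemma ArrivalsClose.abs_cumIn_sub_le {Θ ε B : ℝ} (h : I.ArrivalsClose f α β L tie Θ ε)
    (hf : f.IsFeasible I) (hα : 0 < α) (hβ : 0 < β) (hL : I.IsPacketList β L) (hε : 0 ≤ ε)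
    (hB0 : 0 ≤ B) (hB : ∀ j e a b, a ≤ b → f.inVol j e b - f.inVol j e a ≤ B * (b - a))
    (e : E) {r : ℕ} (hr : ((r : ℝ) - 1) * α < Θ) :
    |f.cumIn e (((r : ℝ) - 1) * α) - β * ((I.induced α β L tie).entered e r).length| ≤
      Fintype.card J * (B * ε + β) := by
  have h1 : f.cumIn e (((r : ℝ) - 1) * α) = ∑ j, f.inVol j e (((r : ℝ) - 1) * α) := rfl
  rw [h1, length_entered_eq_sum, Nat.cast_sum, Finset.mul_sum, ← Finset.sum_sub_distrib]
  refine (Finset.abs_sum_le_sum_abs _ _).trans ?_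
  rw [← nsmul_eq_mul]
  refine Finset.sum_le_card_nsmul _ _ _ fun j _ => ?_
  by_cases hmem : e ∈ I.path j
  · obtain ⟨k, hk, rfl⟩ := List.getElem_of_mem hmem
    exact h.abs_inVol_sub_le hf hα hβ hL hε hB0 hB hk hr
  · rw [hf.inVol_off_path hmem, numIn_off_path hmem]
    simp only [Nat.cast_zero, mul_zero, sub_zero, abs_zero]
    positivity

/-- At the origin, particles and packets appear within the same time step. -/
lemma abs_arrivalAt_zero_sub_le (hf : f.IsFeasible I) (hα : 0 < α) (hβ : 0 < β)
    (hL : I.IsPacketList β L) {j : J} {i : ℕ} (hi1 : 1 ≤ i) (hi : i ≤ ⌊I.mass j / β⌋₊) :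
    |I.arrivalAt f j (i * β) 0 -
      I.refinedArrival (I.induced α β L tie) α β j (I.nodeAt j 0) i| ≤ α := by
  have hpos := I.length_path_pos j
  obtain ⟨-, t, ht1, hlt, hle, hd1, hd2⟩ := refinedArrival_entry (tie := tie) hα hβ hL hi1 hi hpos
  obtain ⟨h0, h1, h2⟩ := hf.arrivalAt_spec (mul_pos (Nat.cast_pos.2 hi1) hβ)
    (natCast_mul_le_mass hβ hi) hpos
  rw [le_numIn_first_iff hα hβ hL hi1 hi] at hle
  have hle' : I.arrivalAt f j (i * β) 0 ≤ t * α := by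
    by_contra! hcon
    have := h2 _ hcon
    rw [hf.inVol_first j (by positivity)] at this
    linarith
  have hlt' : ((t : ℝ) - 1) * α < I.arrivalAt f j (i * β) 0 := by
    by_contra! hcon
    have h3 := hf.inVol_mono j (I.path j)[0] hcon
    have h4 : (t : ℝ) - 1 = (t - 1 : ℕ) := by push_cast [ht1]; ring
    rw [h1, h4, hf.inVol_first j (by positivity), ← le_numIn_first_iff (tie := tie) hα hβ hL hi1 hi,
      Nat.sub_add_cancel ht1] at h3
    omega
  rw [abs_le]
  constructor <;> linarith

/-- Factor by which the distance of arrival times grows in half of the smallest transit time. -/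
noncomputable def growthFactor (I : LoadingInstance V E J) (B : ℝ) : ℝ :=
  9 + (7 * Fintype.card J * B + 8 * Fintype.card J + 4) * ∑ e, (I.ν e)⁻¹

/-- Closeness of arrival times is propagated along one arc. -/
lemma ArrivalsClose.add_halfMinTransit {Θ ε B : ℝ} (h : I.ArrivalsClose f α β L tie Θ ε)
    (hf : f.IsFeasible I) (hα : 0 < α) (hβ : 0 < β) (hβα : β ≤ α) (hL : I.IsPacketList β L)
    (hαε : α ≤ 4 * ε) (hsmall : ε + α < I.halfMinTransit)
    (hB0 : 0 ≤ B) (hB : ∀ j e a b, a ≤ b → f.inVol j e b - f.inVol j e a ≤ B * (b - a)) :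
    I.ArrivalsClose f α β L tie (Θ + I.halfMinTransit) (I.growthFactor B * ε) := by
  have hε : 0 ≤ ε := by linarith
  have hinv : ∀ e, (I.ν e)⁻¹ ≤ ∑ e, (I.ν e)⁻¹ := fun e =>
    Finset.single_le_sum (fun e _ => (inv_pos.2 (I.ν_pos e)).le) (Finset.mem_univ e)
  have hinv0 : 0 ≤ ∑ e, (I.ν e)⁻¹ := Finset.sum_nonneg fun e _ => (inv_pos.2 (I.ν_pos e)).le
  have hcard : (0 : ℝ) ≤ Fintype.card J := Nat.cast_nonneg _
  intro j k hk i hi1 hi hor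
  cases k with
  | zero =>
    refine (abs_arrivalAt_zero_sub_le hf hα hβ hL hi1 hi).trans (hαε.trans ?_)
    refine mul_le_mul_of_nonneg_right ?_ hε
    have : 0 ≤ (7 * Fintype.card J * B + 8 * Fintype.card J + 4) * ∑ e, (I.ν e)⁻¹ := by positivity
    unfold growthFactor
    linarith
  | succ k =>
    have hk' : k < (I.path j).length := hk
    set e := (I.path j)[k] with he
    have hδτ := I.halfMinTransit_le e
    obtain ⟨-, t₀, ht₀, hlt₀, hle₀, hd⟩ := refinedArrival_entry (tie := tie) hα hβ hL hi1 hi hk'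
    obtain ⟨-, t₁, ht₁, hlt₁, hle₁, hd'⟩ := refinedArrival_exit (tie := tie) hα hβ hL hi1 hi hk'
    rw [← he] at hlt₀ hle₀ hlt₁ hle₁
    set x := I.arrivalAt f j (i * β) k with hx
    set d := I.refinedArrival (I.induced α β L tie) α β j (I.nodeAt j k) i
    set d' := I.refinedArrival (I.induced α β L tie) α β j (I.nodeAt j (k + 1)) i
    have hspec := hf.arrivalAt_spec (mul_pos (Nat.cast_pos.2 hi1) hβ)
      (natCast_mul_le_mass hβ hi) hk'
    have hq := induced_isQueueRecursion (I := I) (L := L) (tie := tie) hα hβ e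
    have htau : 1 ≤ (I.induced α β L tie).tauHat e := one_le_tauHat hα e
    -- The packet enters in step `t₀` and leaves in step `t₁`. By FIFO these facts about the counts
    -- of commodity `j` become facts about total numbers, which the queue estimates use.
    have hlo : ((I.induced α β L tie).entered e t₀).length <
        (I.induced α β L tie).numLeft e (t₁ + 1) := by
      by_contra! hcon
      have : I.numOut α β L tie j e (t₁ + 1) ≤ I.numIn α β L tie j e t₀ :=
        PacketRouting.leftCount_le_enteredCount _ htau hcon
      omega
    have hhi : (I.induced α β L tie).numLeft e t₁ <
        ((I.induced α β L tie).entered e (t₀ + 1)).length := by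
      by_contra! hcon
      have : I.numIn α β L tie j e (t₀ + 1) ≤ I.numOut α β L tie j e t₁ :=
        PacketRouting.enteredCount_le_leftCount _ htau hcon
      omega
    -- Crossing the arc takes at least 2δ. One δ leads from Θ + δ back to Θ, the other absorbs ε +
    -- α; so even the end of the entry step lies before Θ.
    have hnear : (t₀ : ℝ) * α < Θ ∧ |x - d| ≤ ε := by
      rcases hor with hor | hor
      · have h1 := hf.arrivalAt_succ_ge (i * β) hk'
        have h2 := h j k hk'.le i hi1 hi (Or.inl (by linarith))
        refine ⟨?_, h2⟩
        have h3 := (abs_le.1 h2).1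
        linarith [hd.1]
      · have h1 : ((t₀ + ⌈I.τ e / α⌉₊ : ℕ) : ℝ) * α ≤ t₁ * α :=
          mul_le_mul_of_nonneg_right (by exact_mod_cast hq.transit_le_exit hlo) hα.le
        have h2 : I.τ e ≤ ⌈I.τ e / α⌉₊ * α := by
          have := Nat.le_ceil (I.τ e / α)
          rwa [div_le_iff₀ hα] at this
        push_cast at h1
        have h3 : (t₀ : ℝ) * α < Θ := by linarith [hd'.1]
        exact ⟨h3, h j k hk'.le i hi1 hi (Or.inr (hd.2.trans_lt h3))⟩
    have hBtot : ∀ a b, a ≤ b → f.cumIn e b - f.cumIn e a ≤ Fintype.card J * B * (b - a) :=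
      fun a b hab => by
        have h1 : f.cumIn e b - f.cumIn e a = ∑ j, (f.inVol j e b - f.inVol j e a) :=
          (Finset.sum_sub_distrib _ _).symm
        rw [h1, mul_assoc, ← nsmul_eq_mul]
        exact Finset.sum_le_card_nsmul _ _ _ fun j _ => hB j e a b hab
    have hη : ∀ r ≤ t₀ + 1, |f.cumIn e (((r : ℝ) - 1) * α) -
        β * ((I.induced α β L tie).entered e r).length| ≤ Fintype.card J * (B * ε + β) :=
      fun r hr => by
        refine h.abs_cumIn_sub_le hf hα hβ hL hε hB0 hB e (lt_of_le_of_lt ?_ hnear.1)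
        have : (r : ℝ) ≤ t₀ + 1 := by exact_mod_cast hr
        exact mul_le_mul_of_nonneg_right (by linarith) hα.le
    have hfin := hf.abs_exitTime_sub_le hα hβ hq hBtot ht₀ hη hlo hhi hspec.1 hd hd' hnear.2
    rw [arrivalAt_succ f (i * β) hk']
    refine hfin.trans ?_
    have hβε : β ≤ 4 * ε := hβα.trans hαε
    -- Origin of the constants in `growthFactor`: α, β ≤ 4ε turns ε + 2α into 9ε, B(ε + α) into 5Bε
    -- with |J|B in place of B, 2η into |J|(2B + 8)ε, and β into 4ε.
    have hnum : Fintype.card J * B * (ε + α) + 2 * (Fintype.card J * (B * ε + β)) + β ≤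
        (7 * Fintype.card J * B + 8 * Fintype.card J + 4) * ε := by
      have h1 : Fintype.card J * B * α ≤ Fintype.card J * B * (4 * ε) :=
        mul_le_mul_of_nonneg_left hαε (by positivity)
      have h2 : Fintype.card J * β ≤ Fintype.card J * (4 * ε) :=
        mul_le_mul_of_nonneg_left hβε (by positivity)
      linarith
    have hdiv : (Fintype.card J * B * (ε + α) + 2 * (Fintype.card J * (B * ε + β)) + β) / I.ν e ≤
        (7 * Fintype.card J * B + 8 * Fintype.card J + 4) * ε * ∑ e, (I.ν e)⁻¹ := by
      rw [div_eq_mul_inv]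
      exact mul_le_mul hnum (hinv e) (inv_pos.2 (I.ν_pos e)).le (by positivity)
    unfold growthFactor
    linarith

/-- Arrival times are close to each other, with an error that grows exponentially in time. -/
lemma arrivalsClose_mul_halfMinTransit {B C : ℝ} (hf : f.IsFeasible I) (hα : 0 < α) (hβ : 0 < β)
    (hβα : β ≤ α) (hL : I.IsPacketList β L) (hB0 : 0 ≤ B)
    (hB : ∀ j e a b, a ≤ b → f.inVol j e b - f.inVol j e a ≤ B * (b - a))
    (hδ : 0 < I.halfMinTransit) (hC4 : 4 ≤ C) (hCg : I.growthFactor B ≤ C)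
    (hα1 : √α ≤ 1) (hαδ : 4 * α ≤ I.halfMinTransit)
    (hH : √α < I.halfMinTransit * C ^ (-(I.horizon f / I.halfMinTransit))) (K : ℕ) :
    I.ArrivalsClose f α β L tie (K * I.halfMinTransit) (√α * C ^ K / 4) := by
  have hC0 : 0 < C := by linarith
  have hsq : √α * √α = α := Real.mul_self_sqrt hα.le
  have hs0 : 0 < √α := Real.sqrt_pos.2 hα
  have hαs : α ≤ √α := by nlinarith
  have hone : ∀ K : ℕ, √α ≤ √α * C ^ K := fun K =>
    le_mul_of_one_le_right hs0.le (one_le_pow₀ (by linarith))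
  induction K with
  | zero =>
    intro j k hk i hi1 hi hor
    exfalso
    rw [Nat.cast_zero, zero_mul] at hor
    rcases hor with hor | hor
    · have h0 := (hf.arrivalAt_spec (mul_pos (Nat.cast_pos.2 hi1) hβ)
        (natCast_mul_le_mass hβ hi) (I.length_path_pos j)).1
      have h1 : ∀ k ≤ (I.path j).length, 0 ≤ I.arrivalAt f j (i * β) k := by
        intro k
        induction k with
        | zero => exact fun _ => h0
        | succ k ih =>
          intro hk
          have := hf.arrivalAt_succ_ge (i * β) hk
          linarith [ih (by omega), I.τ_pos (I.path j)[k]]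
      linarith [h1 k hk]
    · exact absurd hor (not_lt.2 (Real.sInf_nonneg fun θ hθ => hθ.1))
  | succ K ih =>
    have hstep : √α * C ^ (K + 1) / 4 = C * (√α * C ^ K / 4) := by ring
    have hεnn : 0 ≤ √α * C ^ K / 4 := by positivity
    -- Once Kδ exceeds the horizon, every particle has arrived before Kδ, so the previous bound
    -- already covers all pairs.
    rcases lt_or_ge (I.horizon f) (K * I.halfMinTransit) with hlt | hge
    · intro j k hk i hi1 hi _
      refine (ih j k hk i hi1 hi (Or.inl ?_)).trans ?_
      · exact (hf.arrivalAt_le_horizon (mul_pos (Nat.cast_pos.2 hi1) hβ)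
          (natCast_mul_le_mass hβ hi) hk).trans_lt hlt
      · rw [hstep]
        exact le_mul_of_one_le_left hεnn (by linarith)
    · have hpow : √α * C ^ K < I.halfMinTransit := by
        have h1 : C ^ K ≤ C ^ (I.horizon f / I.halfMinTransit) := by
          rw [← Real.rpow_natCast]
          refine Real.rpow_le_rpow_of_exponent_le (by linarith) ?_
          rwa [le_div_iff₀ hδ]
        rw [Real.rpow_neg hC0.le, ← div_eq_mul_inv, lt_div_iff₀ (by positivity)] at hH
        exact (mul_le_mul_of_nonneg_left h1 hs0.le).trans_lt hH
      -- The quarter in the error makes room here: with ε = √α C^K / 4 < δ/4 and α ≤ δ/4 one has ε +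
      -- α < δ, while α ≤ √α ≤ 4ε still holds.
      have := ih.add_halfMinTransit hf hα hβ hβα hL (by linarith [hone K])
        (by linarith) hB0 hB
      intro j k hk i hi1 hi hor
      refine (this j k hk i hi1 hi ?_).trans ?_
      · push_cast at hor
        rwa [add_mul, one_mul] at hor
      · rw [hstep]
        exact mul_le_mul_of_nonneg_right hCg hεnn

end LoadingInstance

theorem theorem1 {V E J : Type*} [DecidableEq V] [Fintype E] [DecidableEq E]
    [Fintype J] [DecidableEq J] (I : LoadingInstance V E J) :
    ∃ C : ℝ, 1 < C ∧
      ∀ f : FlowRates E J, f.IsFeasible I →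
      ∀ α β : ℝ, 0 < α → 0 < β →
      √α < I.halfMinTransit * C ^ (-(I.horizon f / I.halfMinTransit)) →
      β / α < 1 →
      (∀ e, 2 ≤ I.ν e * α / β) →
      ∀ (L : List (J × ℕ)) (tie : TieRule E (J × ℕ)), I.IsPacketList β L →
      ∀ (j : J) (v : V), v ∈ I.nodes (I.path j) →
      ∀ i : ℕ, (j, i) ∈ L →
        IsLeast (I.entrySet j (i * β)) (sInf (I.entrySet j (i * β))) ∧
        IsLeast (I.refinedSet (I.induced α β L tie) α β j v i)
          (I.refinedArrival (I.induced α β L tie) α β j v i) ∧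
        ∀ K : ℕ,
          I.arrival f j v (i * β) < K * I.halfMinTransit ∨
            I.refinedArrival (I.induced α β L tie) α β j v i < K * I.halfMinTransit →
          |I.arrival f j v (i * β) - I.refinedArrival (I.induced α β L tie) α β j v i| ≤
            √α * C ^ K := by
  obtain ⟨B, hB0, hB⟩ := I.exists_inflow_bound
  -- The bound 4 makes α small compared with δ, `halfMinTransit` forces √α ≤ 1, and `growthFactor`
  -- drives the induction. None of them depends on `f`.
  refine ⟨max 4 (max I.halfMinTransit (I.growthFactor B)), lt_max_of_lt_left (by norm_num), ?_⟩
  set C := max 4 (max I.halfMinTransit (I.growthFactor B))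
  have hC4 : 4 ≤ C := le_max_left _ _
  have hCδ : I.halfMinTransit ≤ C := (le_max_left _ _).trans (le_max_right _ _)
  have hCg : I.growthFactor B ≤ C := (le_max_right _ _).trans (le_max_right _ _)
  intro f hf α β hα hβ hH hβα _ L tie hL j v hv i hi
  obtain ⟨hi1, hiM⟩ := (hL.2 j i).1 hi
  have hβα' : β ≤ α := by rw [div_lt_one hα] at hβα; exact hβα.le
  have hφ : 0 < i * β := mul_pos (Nat.cast_pos.2 hi1) hβ
  have hφm := LoadingInstance.natCast_mul_le_mass (I := I) hβ hiM
  have hpos := I.length_path_pos j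
  have : Nonempty E := ⟨(I.path j)[0]⟩
  have hδ : 0 < I.halfMinTransit := I.halfMinTransit_pos
  obtain ⟨k, hk, rfl⟩ := LoadingInstance.exists_nodeAt_eq hv
  -- The first arc alone takes 2δ, so the exponent H/δ in the smallness condition is at least 2.
  have hhor : 2 * I.halfMinTransit ≤ I.horizon f := by
    have h1 := hf.arrivalAt_le_horizon hφ hφm (k := 1) hpos
    have h2 := hf.arrivalAt_succ_ge (i * β) hpos
    have h3 := (hf.arrivalAt_spec hφ hφm hpos).1
    have h4 := I.halfMinTransit_le (I.path j)[0]
    rw [zero_add] at h2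
    linarith
  have hroot : √α * C ^ 2 < I.halfMinTransit := by
    have h1 : C ^ 2 ≤ C ^ (I.horizon f / I.halfMinTransit) := by
      rw [← Real.rpow_natCast]
      refine Real.rpow_le_rpow_of_exponent_le (by linarith) ?_
      rw [le_div_iff₀ hδ]
      exact_mod_cast hhor
    have hH' := hH
    rw [Real.rpow_neg (by linarith), ← div_eq_mul_inv, lt_div_iff₀ (by positivity)] at hH'
    exact (mul_le_mul_of_nonneg_left h1 (Real.sqrt_nonneg _)).trans_lt hH'
  have hs0 : 0 < √α := Real.sqrt_pos.2 hα
  -- From √α C² < δ ≤ C and C ≥ 4.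
  have hα1 : √α ≤ 1 := by nlinarith
  have hsq : √α * √α = α := Real.mul_self_sqrt hα.le
  have hαδ : 4 * α ≤ I.halfMinTransit := by
    have h1 : √α * 16 ≤ √α * C ^ 2 := mul_le_mul_of_nonneg_left (by nlinarith) hs0.le
    have h2 : √α * √α ≤ √α * 1 := mul_le_mul_of_nonneg_left hα1 hs0.le
    linarith
  refine ⟨hf.isLeast_entrySet hφ.le hφm, ?_, fun K hK => ?_⟩
  -- The origin has only an entry description and the destination only an exit description; at inner
  -- nodes the two agree.
  · cases k with
    | zero => exact (LoadingInstance.refinedArrival_entry hα hβ hL hi1 hiM hpos).1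
    | succ k => exact (LoadingInstance.refinedArrival_exit hα hβ hL hi1 hiM hk).1
  · rw [LoadingInstance.arrival_nodeAt f _ hk] at hK ⊢
    have := LoadingInstance.arrivalsClose_mul_halfMinTransit (tie := tie) hf hα hβ hβα' hL hB0
      (hB f hf) hδ hC4 hCg hα1 hαδ hH K j k hk i hi1 hiM hK
    refine this.trans ?_
    have : 0 ≤ √α * C ^ K := by positivity
    linarith
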